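/- **Conventions.** All graphs are finite and simple. For a graph $\Gamma$ and a group $G\le \mathrm{Aut}(\Gamma)$, the graph $\Gamma$ is *$G$-oriented* if $G$ is transitive on the vertices and on the edges of $\Gamma$ but not on its arcs (ordered pairs of adjacent vertices). $\mathcal{OG}(m)$ denotes the set of pairs $(\Gamma,G)$ with $\Gamma$ connected, $m$-valent and $G$-oriented, and $\mathcal{AG}(m)$ the set of pairs with $\Gamma$ connected, $m$-valent and $G$ transitive on the arcs of $\Gamma$. For $N\trianglelefteq G$, the normal quotient $\Gamma_N$ has as vertices the $N$-orbits on $V\Gamma$, two distinct orbits being adjacent if and only if some edge of $\Gamma$ joins them; $\tilde N$ is the kernel of the action of $G$ on the set of $N$-orbits, so that $G/\tilde N$ is a group of automorphisms of $\Gamma_N$. $\mathbf{C}_r$ is the cycle graph of length $r$. A *cyclic normal quotient* is a $\Gamma_N$ with $1\ne N\trianglelefteq G$ and $\Gamma_N\cong\mathbf{C}_r$ for some $r\ge3$. It is *$G$-oriented* if $(\Gamma_N,G/\tilde N)\in\mathcal{OG}(2)$ with $G/\tilde N$ cyclic of order $r$, and *$G$-unoriented* if $(\Gamma_N,G/\tilde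 N)\in\mathcal{AG}(2)$ with $G/\tilde N$ dihedral of order $2r$. Two cyclic normal quotients $\Gamma_M,\Gamma_N$ are *independent* if $\Gamma_K$, with $K=\tilde M\cap\tilde N$, is not a cycle of length at least $3$. A pair $(\Gamma,G)\in\mathcal{OG}(4)$ is *basic* if for every nontrivial normal subgroup $N$ of $G$ the graph $\Gamma_N$ is isomorphic to $K_1$, $K_2$ or $\mathbf{C}_r$ for some $r\ge3$; it is basic *of cycle type* if moreover it has at least one cyclic normal quotient. $\mathrm{soc}(G)$ is the subgroup generated by all minimal normal subgroups of $G$. For $r\ge3$, $t\ge1$, $\overline{\mathbf{C}}_r(2,t)$ is the underlying graph of the digraph with vertex set $\mathbb{Z}_r\times\mathbb{Z}_2^t$ that has an arc from $(i,(x_1,\dots,x_t))$ to $(j,(y_1,\dots,y_t))$ if and only if $j=i+1$ and $(y_1,\dots,y_t)=(y_1,x_1,\dots,x_{t-1})$. **Theorem 1.1.** Suppose $(\Gamma,G)\in\mathcal{OG}(4)$ is basic of cycle type and does not have independent cyclic normal quotients. Then one of the following holds. 1. All cyclic normal quotients of $(\Gamma,G)$ are $G$-oriented, and either - (a) $\mathrm{soc}(G)$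 is a $2$-group and $\Gamma\cong\overline{\mathbf{C}}_r(2,t)$ for some $r\ge3$ and $t\ge1$; or - (b) $G$ has a unique minimal normal subgroup $N\cong T^k$, where $k\ge1$ and $T$ is a simple group with $T\not\cong\mathbb{Z}_2$, and $\Gamma_N\cong\mathbf{C}_r$ for some $r\ge3$. In this case $k\le r2^r$ if $N$ is nonabelian, and $k\le r$ if $N$ is abelian. 2. All cyclic normal quotients of $(\Gamma,G)$ are $G$-unoriented, and $G$ has a unique minimal normal subgroup $N\cong T^k$, where $k\ge1$ and $T$ is a simple group, and $\Gamma_N\cong\mathbf{C}_r$ for some $r\ge3$. In this case $k\le 2r$ if $N$ is nonabelian, and $k\le r-1$ if $N$ is abelian. -/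

import Mathlib

universe u

/-! Graph-group pairs `(Γ, G)` with `G ≤ Aut Γ`; `Γ ≃g Γ` is the automorphism group of `Γ`. -/

namespace GraphPair

section Pairs

variable {V : Type u} (Γ : SimpleGraph V) (G : Subgroup (Γ ≃g Γ))

/-- `G` is transitive on the vertices of `Γ`. -/
def VertexTransitive : Prop :=
  ∀ x y : V, ∃ g ∈ G, g x = y

/-- `G` is transitive on the (unordered) edges of `Γ`. -/
def EdgeTransitive : Prop :=
  ∀ e ∈ Γ.edgeSet, ∀ f ∈ Γ.edgeSet, ∃ g ∈ G, Sym2.map g e = f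

/-- `G` is transitive on the arcs (ordered pairs of adjacent vertices) of `Γ`. -/
def ArcTransitive : Prop :=
  ∀ x y x' y' : V, Γ.Adj x y → Γ.Adj x' y' → ∃ g ∈ G, g x = x' ∧ g y = y'

/-- Every vertex of `Γ` has exactly `m` neighbours (for finite graphs and `m ≥ 1`). -/
def HasValency (m : ℕ) : Prop :=
  ∀ v : V, (Γ.neighborSet v).ncard = m

/-- `Γ` is `G`-oriented (`G`-half-arc-transitive). -/
def IsGOriented : Prop :=
  VertexTransitive Γ G ∧ EdgeTransitive Γ G ∧ ¬ ArcTransitive Γ G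

/-- The family `OG(m)`: connected, `m`-valent, `G`-oriented. -/
def InOG (m : ℕ) : Prop :=
  Γ.Connected ∧ HasValency Γ m ∧ IsGOriented Γ G

/-- The family `AG(m)`: connected, `m`-valent, `G`-arc-transitive. -/
def InAG (m : ℕ) : Prop :=
  Γ.Connected ∧ HasValency Γ m ∧ ArcTransitive Γ G

/-- `Γ` is isomorphic to a cycle graph of length at least three. -/
def IsCycleGraph : Prop :=
  ∃ r : ℕ, 3 ≤ r ∧ Nonempty (Γ ≃g SimpleGraph.cycleGraph r)

/-- `Γ` is isomorphic to `K₁`, `K₂` or a cycle of length at least three. -/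
def IsDegenerate : Prop :=
  Nonempty (Γ ≃g (⊤ : SimpleGraph (Fin 1))) ∨ Nonempty (Γ ≃g (⊤ : SimpleGraph (Fin 2))) ∨
    IsCycleGraph Γ

end Pairs

section Quotients

variable {V : Type u} {Γ : SimpleGraph V} {G : Subgroup (Γ ≃g Γ)}

/-- The quotient graph `Γ_N`: its vertices are the `N`-orbits on the vertices of `Γ`, and two
distinct orbits are adjacent when some edge of `Γ` joins them. -/
def quotientGraph (N : Subgroup G) : SimpleGraph (MulAction.orbitRel.Quotient N V) where
  Adj B C := B ≠ C ∧ ∃ a b : V, Quotient.mk _ a = B ∧ Quotient.mk _ b = C ∧ Γ.Adj a b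
  symm := by
    constructor
    rintro B C ⟨hne, a, b, ha, hb, hab⟩
    exact ⟨hne.symm, b, a, hb, ha, hab.symm⟩
  loopless := by
    constructor
    rintro B ⟨hne, _⟩
    exact hne rfl

/-- The map on `N`-orbits induced by an element of `G`, for `N` normal in `G`. -/
def orbitMap (N : Subgroup G) [hN : N.Normal] (g : G) :
    MulAction.orbitRel.Quotient N V → MulAction.orbitRel.Quotient N V :=
  Quotient.map (fun v => g • v) (by
    rintro a b ⟨n, hn⟩
    refine ⟨⟨g * n * g⁻¹, hN.conj_mem n n.2 g⟩, ?_⟩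
    have hn' : (n : G) • b = a := hn
    change (g * (n : G) * g⁻¹) • (g • b) = g • a
    rw [← hn', smul_smul, smul_smul]
    congr 1
    group)

theorem orbitMap_mul (N : Subgroup G) [N.Normal] (g h : G)
    (B : MulAction.orbitRel.Quotient N V) :
    orbitMap N (g * h) B = orbitMap N g (orbitMap N h B) := by
  induction B using Quotient.inductionOn with
  | h v => exact congrArg (Quotient.mk _) (mul_smul g h v)

theorem orbitMap_one (N : Subgroup G) [N.Normal] (B : MulAction.orbitRel.Quotient N V) :
    orbitMap N (1 : G) B = B := by
  induction B using Quotient.inductionOn with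
  | h v => exact congrArg (Quotient.mk _) (one_smul G v)

/-- The permutation of the `N`-orbits induced by an element of `G`. -/
def orbitPerm (N : Subgroup G) [N.Normal] (g : G) :
    Equiv.Perm (MulAction.orbitRel.Quotient N V) where
  toFun := orbitMap N g
  invFun := orbitMap N g⁻¹
  left_inv B := by rw [← orbitMap_mul, inv_mul_cancel, orbitMap_one]
  right_inv B := by rw [← orbitMap_mul, mul_inv_cancel, orbitMap_one]

theorem quotientGraph_adj_orbitMap (N : Subgroup G) [N.Normal] (g : G)
    {B C : MulAction.orbitRel.Quotient N V} (h : (quotientGraph N).Adj B C) :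
    (quotientGraph N).Adj (orbitMap N g B) (orbitMap N g C) := by
  obtain ⟨hne, a, b, rfl, rfl, hab⟩ := h
  exact ⟨fun e => hne ((orbitPerm N g).injective e), g • a, g • b, rfl, rfl,
    (g : Γ ≃g Γ).map_rel_iff.2 hab⟩

/-- The automorphism of `Γ_N` induced by an element of `G`. -/
def quotientAut (N : Subgroup G) [N.Normal] (g : G) : quotientGraph N ≃g quotientGraph N where
  toEquiv := orbitPerm N g
  map_rel_iff' {B C} := by
    refine ⟨fun h => ?_, quotientGraph_adj_orbitMap N g⟩
    have h' := quotientGraph_adj_orbitMap N g⁻¹ h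
    rwa [show orbitMap N g⁻¹ (orbitPerm N g B) = B from (orbitPerm N g).left_inv B,
      show orbitMap N g⁻¹ (orbitPerm N g C) = C from (orbitPerm N g).left_inv C] at h'

/-- The action of `G` on `Γ_N`. -/
def quotientHom (N : Subgroup G) [N.Normal] : G →* (quotientGraph N ≃g quotientGraph N) where
  toFun := quotientAut N
  map_one' := RelIso.ext (orbitMap_one N)
  map_mul' g h := RelIso.ext (orbitMap_mul N g h)

/-- The group `G_N` of automorphisms of `Γ_N` induced by `G`. -/
def inducedGroup (N : Subgroup G) [N.Normal] : Subgroup (quotientGraph N ≃g quotientGraph N) :=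
  (quotientHom N).range

/-- The kernel `Ñ` of the action of `G` on the set of `N`-orbits. -/
def orbitKernel (N : Subgroup G) [N.Normal] : Subgroup G :=
  (quotientHom N).ker

instance orbitKernel_normal (N : Subgroup G) [N.Normal] : (orbitKernel N).Normal :=
  (quotientHom N).normal_ker

/-- `Γ_N` is a cyclic normal quotient of `(Γ, G)`. -/
def IsCyclicQuotient (N : Subgroup G) [N.Normal] : Prop :=
  N ≠ ⊥ ∧ IsCycleGraph (quotientGraph N)

/-- The cyclic normal quotient `(Γ_N, G_N)` is a cycle of length `r` on which `G` induces the
cyclic group of order `r`, as a member of `OG(2)`. -/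
def IsOrientedQuotient (N : Subgroup G) [N.Normal] : Prop :=
  ∃ r : ℕ, 3 ≤ r ∧ Nonempty (quotientGraph N ≃g SimpleGraph.cycleGraph r) ∧
    Nonempty (inducedGroup N ≃* Multiplicative (ZMod r)) ∧
    InOG (quotientGraph N) (inducedGroup N) 2

/-- The cyclic normal quotient `(Γ_N, G_N)` is a cycle of length `r` on which `G` induces the
dihedral group of order `2r`, as a member of `AG(2)`. -/
def IsUnorientedQuotient (N : Subgroup G) [N.Normal] : Prop :=
  ∃ r : ℕ, 3 ≤ r ∧ Nonempty (quotientGraph N ≃g SimpleGraph.cycleGraph r) ∧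
    Nonempty (inducedGroup N ≃* DihedralGroup r) ∧
    InAG (quotientGraph N) (inducedGroup N) 2

/-- The cyclic normal quotients `Γ_M` and `Γ_N` are independent: `Γ_K` is not a cycle, where
`K = M̃ ∩ Ñ`. -/
def AreIndependent (M N : Subgroup G) [M.Normal] [N.Normal] : Prop :=
  ¬ IsCycleGraph (quotientGraph (orbitKernel M ⊓ orbitKernel N))

variable (Γ G)

/-- `(Γ, G)` is a basic member of `OG(4)`. -/
def IsBasic : Prop :=
  InOG Γ G 4 ∧ ∀ (N : Subgroup G) [N.Normal], N ≠ ⊥ → IsDegenerate (quotientGraph N)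

/-- `(Γ, G)` is basic of cycle type. -/
def IsBasicOfCycleType : Prop :=
  IsBasic Γ G ∧ ∃ (N : Subgroup G) (_ : N.Normal), IsCyclicQuotient N

/-- `(Γ, G)` has a pair of independent cyclic normal quotients. -/
def HasIndependentCyclicQuotients : Prop :=
  ∃ (M N : Subgroup G) (_ : M.Normal) (_ : N.Normal),
    IsCyclicQuotient M ∧ IsCyclicQuotient N ∧ AreIndependent M N

end Quotients

section Groups

variable {H : Type u} [Group H]

/-- `N` is a minimal normal subgroup of `H`. -/
def IsMinimalNormal (N : Subgroup H) : Prop :=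
  N.Normal ∧ N ≠ ⊥ ∧ ∀ M : Subgroup H, M.Normal → M ≠ ⊥ → M ≤ N → M = N

/-- `N` is the unique minimal normal subgroup of `H`. -/
def IsUniqueMinimalNormal (N : Subgroup H) : Prop :=
  IsMinimalNormal N ∧ ∀ M : Subgroup H, IsMinimalNormal M → M = N

variable (H)

/-- The socle of `H`: the subgroup generated by all minimal normal subgroups. -/
def socle : Subgroup H :=
  sSup {N : Subgroup H | IsMinimalNormal N}

end Groups

/-- The arcs of the digraph `C_r(v, s)` on `ℤ_r × ℤ_v^s`: there is an arc from `(i, x)` to `(j, y)`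
exactly when `j = i + 1` and `y = (y₁, x₁, …, x_{s-1})`. -/
def highlyArcTransitiveDigraph (r v s : ℕ) : Digraph (ZMod r × (Fin s → ZMod v)) where
  Adj p q := q.1 = p.1 + 1 ∧ ∀ a b : Fin s, (b : ℕ) = (a : ℕ) + 1 → q.2 b = p.2 a

/-- The underlying simple graph of `C_r(v, s)`. -/
def highlyArcTransitiveGraph (r v s : ℕ) : SimpleGraph (ZMod r × (Fin s → ZMod v)) :=
  SimpleGraph.fromRel (highlyArcTransitiveDigraph r v s).Adj

end GraphPair

/-!
Fix one of the two orbits of `G` on the arcs of `Γ`. This orientation `E` has in- and out-valency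
two and is strongly connected, so a set of vertices closed under out-neighbours is empty or
everything; in particular vertex stabilisers are `2`-groups. A cyclic normal quotient amounts to a
level function `ℓ : V → ℤ_r` with the orbits of `N` as level sets. Arcs change the level by `±1`,
`G` acts on the levels by affine maps `x ↦ ±x + c`, and either all arcs go one level up (oriented
case) or each vertex has one arc going up and one going down (unoriented case).

In the absence of independent cyclic normal quotients there is a finest one, with kernel `K` say,
and all cyclic normal quotients have the same type (`exists_isFinestCyclic`). Every minimal normal
subgroup `N` lies in `K` and has the levels as its orbits (`IsMinimalNormal.isFinestCyclic`).
Moreover `N ≅ T ^ k` with `T` simple and `k ≤ |G : N|`, since the factors may be taken to be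
distinct conjugates of one subgroup that `N` normalises (`IsMinimalNormal.exists_mulEquiv_pi`).

In the unoriented case `K` acts semiregularly, so `N = K` is unique and `|G : N| = 2r`. If `N` is
abelian, the conjugates by rotations of an element centralised or inverted by a reflection yield
`r - 1` generators.

In the oriented case `|G : N| ≤ r 2 ^ r` (`LevelAction.index_le`): passing to line digraphs makes
`N` semiregular, and then an element fixing a directed path of length `r` is trivial. Elements of
`K` have a `2`-power power in `N`. If some minimal normal subgroup is a `2`-group, so is `K`; then
`N` is central in `K`, which forces `K` to be abelian, and collapsing vertices with the same
out-neighbours exhibits `E` as an iterated line digraph of a cycle with doubled arcs, that is, as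
`C_r(2, t)` (`LocallyAbelian.exists_equiv`). Otherwise `N` is unique, as two minimal normal
subgroups intersect trivially; if `N` is abelian, it is semiregular and generated by one element
for each level.
-/

/-! ### Minimal normal subgroups of finite groups -/

namespace GraphPair

section Groups

variable {H : Type u} [Group H]

theorem exists_isMinimalNormal_le [Finite H] {N : Subgroup H} (hN : N.Normal) (hne : N ≠ ⊥) :
    ∃ M, IsMinimalNormal M ∧ M ≤ N := by
  have hfin : {M : Subgroup H | M.Normal ∧ M ≠ ⊥ ∧ M ≤ N}.Finite := Set.toFinite _
  obtain ⟨M, hM⟩ := hfin.exists_minimal ⟨N, hN, hne, le_rfl⟩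
  refine ⟨M, ⟨hM.1.1, hM.1.2.1, fun L hL hLne hLM => ?_⟩, hM.1.2.2⟩
  exact le_antisymm hLM (hM.2 ⟨hL, hLne, hLM.trans hM.1.2.2⟩ hLM)

theorem IsMinimalNormal.le_or_inf_eq_bot {N M : Subgroup H} (hN : IsMinimalNormal N)
    (hM : M.Normal) : N ≤ M ∨ N ⊓ M = ⊥ := by
  by_cases h : N ⊓ M = ⊥
  · exact Or.inr h
  · have := hN.1
    exact Or.inl (inf_eq_left.1 (hN.2.2 (N ⊓ M) inferInstance h inf_le_left))

theorem IsMinimalNormal.inf_eq_bot {N M : Subgroup H} (hN : IsMinimalNormal N)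
    (hM : IsMinimalNormal M) (h : N ≠ M) : N ⊓ M = ⊥ :=
  (hN.le_or_inf_eq_bot hM.1).resolve_left fun hle => h (hM.2.2 N hN.1 hN.2.1 hle)

/-- A set of elements of a minimal normal subgroup that is closed under conjugation and contains
a nontrivial element generates it. -/
theorem IsMinimalNormal.closure_eq {N : Subgroup H} (hN : IsMinimalNormal N) {D : Set H}
    (hD : D ⊆ N) (hconj : ∀ x ∈ D, ∀ g : H, g * x * g⁻¹ ∈ D) {x : H} (hx : x ∈ D) (hx1 : x ≠ 1) :
    Subgroup.closure D = N := by
  have hnorm : (Subgroup.closure D).Normal := by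
    refine ⟨fun y hy g => ?_⟩
    induction hy using Subgroup.closure_induction with
    | mem x hx => exact Subgroup.subset_closure (hconj x hx g)
    | one => simp
    | mul x y _ _ hx hy => simpa using mul_mem hx hy
    | inv x _ hx => simpa [mul_assoc] using inv_mem hx
  refine hN.2.2 _ hnorm ?_ ((Subgroup.closure_le _).2 hD)
  exact fun h => hx1 (by simpa [h] using Subgroup.subset_closure hx)

/-- A minimal normal subgroup of a finite group is a direct power of a simple group; the number
of factors is at most the number of conjugates of a factor, hence at most the index. -/
theorem IsMinimalNormal.exists_mulEquiv_pi [Finite H] {N : Subgroup H} (hN : IsMinimalNormal N) :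
    ∃ (T : Type u) (_ : Group T) (k : ℕ), IsSimpleGroup T ∧ 1 ≤ k ∧
      Nonempty (N ≃* (Fin k → T)) ∧ k ≤ N.index := by
  classical
  have hNn := hN.1
  -- `T` has least order among the nontrivial subgroups of `N` normalised by `N`
  obtain ⟨T, ⟨hT1, hTN, hTn⟩, hTmin⟩ := exists_minimalFor_of_wellFoundedLT
    (fun S : Subgroup H => S ≠ ⊥ ∧ S ≤ N ∧ ∀ n ∈ N, ∀ s ∈ S, n * s * n⁻¹ ∈ S)
    (fun S => Nat.card S) ⟨N, hN.2.1, le_rfl, fun n hn s hs => hNn.conj_mem s hs n⟩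
  have hTeq : ∀ S : Subgroup H, S ≠ ⊥ → S ≤ N → (∀ n ∈ N, ∀ s ∈ S, n * s * n⁻¹ ∈ S) →
      Nat.card T ≤ Nat.card S := by
    intro S h1 h2 h3
    rcases le_total (Nat.card T) (Nat.card S) with h | h
    · exact h
    · exact hTmin ⟨h1, h2, h3⟩ h
  let C : H → Subgroup H := fun g => T.map (MulAut.conj g).toMonoidHom
  have hCmem : ∀ g t, t ∈ C g ↔ g⁻¹ * t * g ∈ T := by
    intro g t
    simp only [C, Subgroup.mem_map]
    constructor
    · rintro ⟨x, hx, rfl⟩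
      simpa [mul_assoc] using hx
    · intro h
      exact ⟨_, h, by simp [mul_assoc]⟩
  have hCN : ∀ g, C g ≤ N := by
    intro g t ht
    have := hNn.conj_mem _ (hTN ((hCmem g t).1 ht)) g
    simpa [mul_assoc] using this
  have hCn : ∀ g, ∀ n ∈ N, ∀ s ∈ C g, n * s * n⁻¹ ∈ C g := by
    intro g n hn s hs
    rw [hCmem] at hs ⊢
    have := hTn (g⁻¹ * n * g) (by simpa using hNn.conj_mem n hn g⁻¹) _ hs
    convert this using 1
    group
  have hCcard : ∀ g, Nat.card (C g) = Nat.card T := fun g =>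
    (Nat.card_congr (T.equivMapOfInjective _ (MulAut.conj g).injective).toEquiv).symm
  -- a direct power of `T` of greatest possible length inside `N`, normalised by `N` and containing
  -- that many conjugates of `T`, is all of `N`
  let P : ℕ → Prop := fun k => ∃ f : (Fin k → T) →* H, Function.Injective f ∧ f.range ≤ N ∧
    (∀ n ∈ N, ∀ s ∈ f.range, n * s * n⁻¹ ∈ f.range) ∧
    ∃ s : Finset (Subgroup H), s.card = k ∧ ∀ S ∈ s, S ≤ f.range ∧ ∃ g, S = C g
  have hP0 : P 0 := by
    refine ⟨1, fun a b _ => Subsingleton.elim _ _, ?_, ?_, ∅, rfl, by simp⟩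
    · rintro _ ⟨x, rfl⟩
      exact N.one_mem
    · rintro n hn _ ⟨x, rfl⟩
      exact ⟨1, by simp⟩
  have hCcoset : ∀ g h : H, (g : H ⧸ N) = h → C g = C h := by
    intro g h hgh
    rw [QuotientGroup.eq] at hgh
    ext t
    rw [hCmem, hCmem]
    constructor
    · intro ht
      have := hTn _ (N.inv_mem hgh) _ ht
      convert this using 1
      group
    · intro ht
      have := hTn _ hgh _ ht
      convert this using 1
      group
  have hPle : ∀ k, P k → k ≤ N.index := by
    rintro k ⟨f, -, -, -, s, rfl, hs⟩
    have hsub : (s : Set (Subgroup H)) ⊆ Set.range fun q : H ⧸ N => C q.out := by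
      intro S hS
      obtain ⟨g, rfl⟩ := (hs S hS).2
      exact ⟨g, hCcoset _ _ (Quotient.out_eq' _)⟩
    rw [← Set.ncard_coe_finset]
    refine (Set.ncard_le_ncard hsub (Set.toFinite _)).trans ?_
    rw [← Nat.card_coe_set_eq]
    exact Finite.card_range_le _
  obtain ⟨k, hk, hkmax⟩ : ∃ k, P k ∧ ∀ j, P j → j ≤ k :=
    ⟨Nat.findGreatest P N.index, Nat.findGreatest_spec (Nat.zero_le _) hP0,
      fun j hj => Nat.le_findGreatest (hPle j hj) hj⟩
  obtain ⟨f, hfi, hfN, hfn, s, hs, hsf⟩ := id hk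
  have hCle : ∀ g, C g ≤ f.range := by
    by_contra! hcon
    obtain ⟨g, hg⟩ := hcon
    have hdisj : C g ⊓ f.range = ⊥ := by
      by_contra hne
      have h := hTeq (C g ⊓ f.range) hne (inf_le_left.trans (hCN g))
        fun n hn s hs => ⟨hCn g n hn s hs.1, hfn n hn s hs.2⟩
      rw [← hCcard g] at h
      have := Subgroup.eq_of_le_of_card_ge inf_le_left h
      exact hg (inf_eq_left.1 this)
    have hcomm : ∀ x ∈ C g, ∀ y ∈ f.range, Commute x y := by
      intro x hx y hy
      have h1 : x * y * x⁻¹ * y⁻¹ ∈ C g ⊓ f.range := by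
        refine ⟨?_, ?_⟩
        · have := (C g).mul_mem hx (hCn g y (hfN hy) _ ((C g).inv_mem hx))
          simpa [mul_assoc] using this
        · exact f.range.mul_mem (hfn x (hCN g hx) y hy) (f.range.inv_mem hy)
      rw [hdisj, Subgroup.mem_bot, mul_inv_eq_one, mul_inv_eq_iff_eq_mul] at h1
      exact h1
    let c : T →* H := (MulAut.conj g).toMonoidHom.comp T.subtype
    have hcC : ∀ t, c t ∈ C g := fun t => ⟨t, t.2, rfl⟩
    have hcomm' : ∀ t x, Commute (c t) (f x) := fun t x => hcomm _ (hcC t) _ ⟨x, rfl⟩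
    let F : T × (Fin k → T) →* H := c.noncommCoprod f hcomm'
    have hF : ∀ p, F p = c p.1 * f p.2 := fun p => rfl
    have hci : Function.Injective c := (MulAut.conj g).injective.comp Subtype.val_injective
    have hFi : Function.Injective F := by
      rw [injective_iff_map_eq_one]
      rintro ⟨t, x⟩ h
      rw [hF] at h
      have h2 : c t ∈ C g ⊓ f.range := ⟨hcC t, by
        rw [mul_eq_one_iff_eq_inv.1 h]; exact f.range.inv_mem ⟨x, rfl⟩⟩
      rw [hdisj, Subgroup.mem_bot] at h2
      rw [h2, one_mul] at h
      exact Prod.ext (hci (h2.trans c.map_one.symm)) (hfi (h.trans f.map_one.symm))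
    let e : (Fin (k + 1) → T) ≃* T × (Fin k → T) :=
      { Fin.consEquiv (fun _ => T) |>.symm with
        map_mul' := fun a b => rfl }
    have hrange : ∀ y, y ∈ (F.comp e.toMonoidHom).range ↔ ∃ a ∈ C g, ∃ b ∈ f.range, y = a * b := by
      intro y
      constructor
      · rintro ⟨x, rfl⟩
        exact ⟨_, hcC _, _, ⟨_, rfl⟩, rfl⟩
      · rintro ⟨_, ⟨t, ht, rfl⟩, _, ⟨x, rfl⟩, rfl⟩
        exact ⟨e.symm (⟨t, ht⟩, x), by simp [hF]; rfl⟩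
    have : k + 1 ≤ k := by
      refine hkmax (k + 1)
        ⟨F.comp e.toMonoidHom, hFi.comp e.injective, ?_, ?_, insert (C g) s, ?_, ?_⟩
      · intro y hy
        obtain ⟨a, ha, b, hb, rfl⟩ := (hrange y).1 hy
        exact N.mul_mem (hCN g ha) (hfN hb)
      · intro n hn y hy
        obtain ⟨a, ha, b, hb, rfl⟩ := (hrange y).1 hy
        refine (hrange _).2 ⟨_, hCn g n hn a ha, _, hfn n hn b hb, by group⟩
      · rw [Finset.card_insert_of_notMem, hs]
        exact fun h => hg (hsf _ h).1
      · intro S hS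
        rcases Finset.mem_insert.1 hS with rfl | hS
        · exact ⟨fun a ha => (hrange a).2 ⟨a, ha, 1, f.range.one_mem, by simp⟩, g, rfl⟩
        · exact ⟨fun b hb => (hrange b).2 ⟨1, (C g).one_mem, b, (hsf S hS).1 hb, by simp⟩,
            (hsf S hS).2⟩
    omega
  have hrange : f.range = N := by
    refine le_antisymm hfN ?_
    obtain ⟨⟨x, hx⟩, hx1'⟩ := Subgroup.ne_bot_iff_exists_ne_one.1 hT1
    have hx1 : x ≠ 1 := fun h => hx1' (Subtype.ext h)
    rw [← hN.closure_eq (D := {t | ∃ g, t ∈ C g}) (fun t ⟨g, ht⟩ => hCN g ht) ?_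
      ⟨1, (hCmem 1 _).2 (by simpa using hx)⟩ hx1, Subgroup.closure_le]
    · rintro t ⟨g, ht⟩
      exact hCle g ht
    · rintro t ⟨g, ht⟩ a
      refine ⟨a * g, ?_⟩
      rw [hCmem] at ht ⊢
      convert ht using 1
      group
  let e : N ≃* (Fin k → T) :=
    ((MonoidHom.ofInjective hfi).trans (MulEquiv.subgroupCongr hrange)).symm
  have hk1 : 1 ≤ k := by
    by_contra! h0
    obtain rfl : k = 0 := by omega
    have : Subsingleton N := e.toEquiv.subsingleton
    exact hN.2.1 (Subgroup.eq_bot_of_subsingleton N)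
  obtain ⟨k, rfl⟩ : ∃ j, k = j + 1 := ⟨k - 1, by omega⟩
  have hTnt : Nontrivial T := (Subgroup.nontrivial_iff_ne_bot T).2 hT1
  refine ⟨T, inferInstance, k + 1, ⟨fun S hS => ?_⟩, hk1, ⟨e⟩, hPle _ hk⟩
  rw [or_iff_not_imp_left]
  intro hS1
  -- the elements supported on the first coordinate, with value in `S`, form a subgroup that `N`
  -- normalises and whose order is that of `S`
  let j : T →* H := f.comp (MonoidHom.mulSingle (fun _ : Fin (k + 1) => T) 0)
  have hji : Function.Injective j := hfi.comp
    (Pi.mulSingle_injective (M := fun _ : Fin (k + 1) => T) 0)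
  have hle := hTeq (S.map j) ?_ ?_ ?_
  · have hc : Nat.card (S.map j) = Nat.card S :=
      (Nat.card_congr (S.equivMapOfInjective j hji).toEquiv).symm
    rw [hc] at hle
    exact Subgroup.eq_top_of_le_card S hle
  · rwa [Ne, Subgroup.map_eq_bot_iff_of_injective _ hji]
  · rintro _ ⟨t, ht, rfl⟩
    exact hfN ⟨_, rfl⟩
  · rintro n hn _ ⟨t, ht, rfl⟩
    rw [← hrange] at hn
    obtain ⟨x, rfl⟩ := hn
    refine ⟨x 0 * t * (x 0)⁻¹, hS.conj_mem t ht _, ?_⟩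
    simp only [j, MonoidHom.comp_apply, ← map_inv, ← map_mul]
    congr 1
    ext i
    refine congrArg Subtype.val ?_
    by_cases hi : i = 0
    · subst hi
      simp
    · simp [hi]

/-- In a commutative subgroup isomorphic to `T ^ k` with `T` simple, every generating family has
at least `k` members: `T` has prime order `p`, so `m` elements generate at most `p ^ m`. -/
theorem le_card_of_mulEquiv_pi {N : Subgroup H} [Finite N] (hcomm : ∀ a ∈ N, ∀ b ∈ N, a * b = b * a)
    {T : Type u} [Group T] [IsSimpleGroup T] {k : ℕ} (e : N ≃* (Fin k → T)) {ι : Type*} [Fintype ι]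
    (y : ι → H) (hy : Subgroup.closure (Set.range y) = N) : k ≤ Fintype.card ι := by
  classical
  rcases Nat.eq_zero_or_pos k with rfl | hk
  · exact Nat.zero_le _
  have : Finite (Fin k → T) := Finite.of_equiv _ e.toEquiv
  have : Finite T := Finite.of_injective (fun t : T => (fun _ : Fin k => t))
    fun a b h => congrFun h ⟨0, hk⟩
  have hTcomm : ∀ a b : T, a * b = b * a := by
    intro a b
    have h : e.symm (fun _ => a) * e.symm (fun _ => b) =
        e.symm (fun _ => b) * e.symm (fun _ => a) :=
      Subtype.ext (hcomm _ (e.symm _).2 _ (e.symm _).2)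
    rw [← map_mul, ← map_mul] at h
    exact congrFun (e.symm.injective h) ⟨0, hk⟩
  let _ : CommGroup T := { ‹Group T› with mul_comm := hTcomm }
  have hp : (Nat.card T).Prime := IsSimpleGroup.prime_card
  set p := Nat.card T with hpdef
  have hpow : ∀ x ∈ N, x ^ p = 1 := by
    intro x hx
    have h : (⟨x, hx⟩ : N) ^ p = 1 := by
      apply e.injective
      rw [map_pow, map_one]
      ext i
      exact pow_card_eq_one' (x := e ⟨x, hx⟩ i)
    exact congrArg Subtype.val h
  have hyN : ∀ i, y i ∈ N := fun i => hy ▸ Subgroup.subset_closure ⟨i, rfl⟩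
  let _ : CommGroup N := { (inferInstance : Group N) with
    mul_comm := fun a b => Subtype.ext (hcomm a a.2 b b.2) }
  let z : ι → N := fun i => ⟨y i, hyN i⟩
  have hzp : ∀ a : N, a ^ p = 1 := fun a => Subtype.ext (hpow a a.2)
  have : NeZero p := ⟨hp.ne_zero⟩
  let Φ : (ι → ℕ) → N := fun c => ∏ i, z i ^ c i
  have hΦmod : ∀ c, Φ (fun i => c i % p) = Φ c := by
    intro c
    refine Finset.prod_congr rfl fun i _ => ?_
    exact (pow_eq_pow_mod (c i) (hzp (z i))).symm
  have hsurj : ∀ a ∈ Subgroup.closure (Set.range y), ∃ c, (Φ c : H) = a := by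
    intro a ha
    induction ha using Subgroup.closure_induction with
    | mem x hx =>
      obtain ⟨i, rfl⟩ := hx
      refine ⟨Pi.single i 1, ?_⟩
      have : Φ (Pi.single i 1) = z i := by
        simp only [Φ]
        rw [Finset.prod_eq_single i]
        · simp
        · intro j _ hj
          simp [hj]
        · simp
      rw [this]
    | one => exact ⟨0, by simp [Φ]⟩
    | mul x y _ _ hx hy =>
      obtain ⟨c, rfl⟩ := hx
      obtain ⟨d, rfl⟩ := hy
      refine ⟨c + d, ?_⟩
      rw [← Subgroup.coe_mul]
      congr 1
      simp [Φ, pow_add, Finset.prod_mul_distrib]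
    | inv x _ hx =>
      obtain ⟨c, rfl⟩ := hx
      refine ⟨fun i => (p - 1) * c i, ?_⟩
      rw [← Subgroup.coe_inv]
      congr 1
      rw [eq_inv_iff_mul_eq_one]
      simp only [Φ]
      rw [← Finset.prod_mul_distrib]
      refine Finset.prod_eq_one fun i _ => ?_
      rw [← pow_add]
      have : (p - 1) * c i + c i = p * c i := by
        obtain ⟨q, hq⟩ : ∃ q, p = q + 1 := ⟨p - 1, by have := hp.pos; omega⟩
        rw [hq]
        simp
        ring
      rw [this, pow_mul, hzp, one_pow]
  have hcardle : Nat.card N ≤ p ^ Fintype.card ι := by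
    let Ψ : (ι → Fin p) → N := fun c => Φ fun i => c i
    have hΨ : Function.Surjective Ψ := by
      intro a
      obtain ⟨c, hc⟩ := hsurj a (hy ▸ a.2)
      refine ⟨fun i => ⟨c i % p, Nat.mod_lt _ hp.pos⟩, ?_⟩
      rw [← Subtype.ext hc, ← hΦmod c]
    calc Nat.card N ≤ Nat.card (ι → Fin p) := Nat.card_le_card_of_surjective Ψ hΨ
      _ = p ^ Fintype.card ι := by simp [Nat.card_eq_fintype_card]
  have hcard : Nat.card N = p ^ k := by
    rw [Nat.card_congr e.toEquiv, Nat.card_pi]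
    simp [hpdef]
  rw [hcard] at hcardle
  exact (Nat.pow_le_pow_iff_right hp.one_lt).1 hcardle

end Groups
end GraphPair

/-! ### Digraphs with a locally transitive abelian group of automorphisms -/

namespace GraphPair

section Shift

/-- Two vertices of a digraph are *twins* when they have the same out-neighbours. -/
def twinSetoid {X : Type u} (E : X → X → Prop) : Setoid X where
  r a b := ∀ w, E a w ↔ E b w
  iseqv := ⟨fun _ _ => Iff.rfl, fun h w => (h w).symm, fun h h' w => (h w).trans (h' w)⟩

/-- The arcs of the quotient of a digraph by the twin relation. -/
def twinRel {X : Type u} (E : X → X → Prop) (p q : Quotient (twinSetoid E)) : Prop :=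
  ∃ a b, E a b ∧ Quotient.mk _ a = p ∧ Quotient.mk _ b = q

/-- A finite strongly connected digraph of out-valency two whose automorphism group is transitive
on the vertices, with a level function onto a cycle, and with a commutative group of automorphisms
for which the stabiliser of a vertex is transitive on its out-neighbours and on its
in-neighbours. -/
structure LocallyAbelian {X : Type u} (E : X → X → Prop) {A : Type u} [Group A]
    (φ : A →* Equiv.Perm X) {r : ℕ} (ℓ : X → ZMod r) : Prop where
  homogeneous : ∀ u v, ∃ f : Equiv.Perm X, (∀ a b, E a b ↔ E (f a) (f b)) ∧ f u = v
  out_two : ∀ u, ∃ w w', w ≠ w' ∧ ∀ z, E u z ↔ z = w ∨ z = w'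
  in_two : ∀ w, ∃ u u', u ≠ u' ∧ E u w ∧ E u' w
  comm : ∀ a b x, φ a (φ b x) = φ b (φ a x)
  rel : ∀ a u w, E u w → E (φ a u) (φ a w)
  out_trans : ∀ u w w', E u w → E u w' → ∃ a, φ a u = u ∧ φ a w = w'
  in_trans : ∀ w u u', E u w → E u' w → ∃ a, φ a w = w ∧ φ a u = u'
  closed : ∀ S : Set X, S.Nonempty → (∀ u ∈ S, ∀ w, E u w → w ∈ S) → S = Set.univ
  level : ∀ u w, E u w → ℓ w = ℓ u + 1

namespace LocallyAbelian

variable {X : Type u} {E : X → X → Prop} {A : Type u} [Group A] {φ : A →* Equiv.Perm X} {r : ℕ}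
  {ℓ : X → ZMod r}

/-- Vertices with a common out-neighbour have the same out-neighbours. -/
theorem twin (h : LocallyAbelian E φ ℓ) {u u' w : X} (hu : E u w) (hu' : E u' w) :
    (twinSetoid E).r u u' := by
  have key : ∀ {u u' w z : X}, E u w → E u' w → E u z → E u' z := by
    intro u u' w z hu hu' hz
    obtain ⟨a, haw, hau⟩ := h.in_trans w u u' hu hu'
    obtain ⟨b, hbu, hbw⟩ := h.out_trans u w z hu hz
    have : φ a z = z := by rw [← hbw, h.comm, haw]
    have hz' := h.rel a u z hz
    rwa [hau, this] at hz'
  exact fun z => ⟨key hu hu', key hu' hu⟩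

theorem twin_aut (f : Equiv.Perm X) (hf : ∀ a b, E a b ↔ E (f a) (f b)) (u v : X) :
    (twinSetoid E).r u v ↔ (twinSetoid E).r (f u) (f v) := by
  constructor
  · intro h w
    obtain ⟨w, rfl⟩ := f.surjective w
    rw [← hf, ← hf]
    exact h w
  · intro h w
    rw [hf, hf v]
    exact h _

/-- The permutation of the twin classes induced by an automorphism. -/
def twinPerm (f : Equiv.Perm X) (hf : ∀ a b, E a b ↔ E (f a) (f b)) :
    Equiv.Perm (Quotient (twinSetoid E)) :=
  Quotient.congr f (twin_aut f hf)

theorem rel_iff (h : LocallyAbelian E φ ℓ) (a : A) (u w : X) : E u w ↔ E (φ a u) (φ a w) := by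
  refine ⟨h.rel a u w, fun hE => ?_⟩
  simpa [← Equiv.Perm.mul_apply, ← map_mul] using h.rel a⁻¹ _ _ hE

/-- The action on the twin classes. -/
def twinHom (h : LocallyAbelian E φ ℓ) : A →* Equiv.Perm (Quotient (twinSetoid E)) where
  toFun a := twinPerm (φ a) (h.rel_iff a)
  map_one' := by
    ext p
    induction p using Quotient.inductionOn
    simp [twinPerm]
  map_mul' a b := by
    ext p
    induction p using Quotient.inductionOn
    simp [twinPerm]

theorem exists_out (h : LocallyAbelian E φ ℓ) (u : X) : ∃ w, E u w := by
  obtain ⟨w, w', -, hw⟩ := h.out_two u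
  exact ⟨w, (hw w).2 (Or.inl rfl)⟩

theorem level_twin (h : LocallyAbelian E φ ℓ) {u v : X} (huv : (twinSetoid E).r u v) :
    ℓ u = ℓ v := by
  obtain ⟨w, hw⟩ := h.exists_out u
  have h1 := h.level u w hw
  rw [h.level v w ((huv w).1 hw)] at h1
  exact (add_right_cancel h1).symm

/-- The level function on the twin classes. -/
def twinLevel (h : LocallyAbelian E φ ℓ) : Quotient (twinSetoid E) → ZMod r :=
  Quotient.lift ℓ fun _ _ => h.level_twin

theorem twinRel_mk (u w : X) (hw : E u w) :
    twinRel E (Quotient.mk _ u) (Quotient.mk _ w) := ⟨u, w, hw, rfl, rfl⟩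

theorem exists_of_twinRel_mk {u : X} {q : Quotient (twinSetoid E)}
    (hq : twinRel E (Quotient.mk _ u) q) : ∃ w, E u w ∧ Quotient.mk _ w = q := by
  obtain ⟨a, b, hab, ha, hb⟩ := hq
  exact ⟨b, (Quotient.exact ha b).1 hab, hb⟩

/-- When the out-neighbours of a vertex are never twins, the twin classes form a digraph of the
same kind. -/
theorem twinQuotient (h : LocallyAbelian E φ ℓ)
    (hsep : ∀ u w w', E u w → E u w' → (twinSetoid E).r w w' → w = w') :
    LocallyAbelian (twinRel E) h.twinHom h.twinLevel where
  homogeneous p q := by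
    induction p using Quotient.inductionOn with | h u
    induction q using Quotient.inductionOn with | h v
    obtain ⟨f, hf, hfu⟩ := h.homogeneous u v
    refine ⟨twinPerm f hf, fun p q => ⟨?_, ?_⟩, congrArg (Quotient.mk _) hfu⟩
    · rintro ⟨a, b, hab, rfl, rfl⟩
      exact ⟨f a, f b, (hf a b).1 hab, rfl, rfl⟩
    · induction p using Quotient.inductionOn with | h a
      induction q using Quotient.inductionOn with | h b
      intro hE
      obtain ⟨w, hw, hwb⟩ := exists_of_twinRel_mk (u := f a) hE
      obtain ⟨w, rfl⟩ := f.surjective w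
      exact ⟨a, w, (hf _ _).2 hw, rfl, Quotient.sound ((twin_aut f hf w b).2 (Quotient.exact hwb))⟩
  out_two p := by
    induction p using Quotient.inductionOn with | h u
    obtain ⟨w, w', hne, hw⟩ := h.out_two u
    have hEw := (hw w).2 (Or.inl rfl)
    have hEw' := (hw w').2 (Or.inr rfl)
    refine ⟨Quotient.mk _ w, Quotient.mk _ w', fun he =>
      hne (hsep u w w' hEw hEw' (Quotient.exact he)), fun z => ⟨fun hz => ?_, ?_⟩⟩
    · obtain ⟨x, hx, rfl⟩ := exists_of_twinRel_mk hz
      rcases (hw x).1 hx with rfl | rfl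
      exacts [Or.inl rfl, Or.inr rfl]
    · rintro (rfl | rfl)
      exacts [twinRel_mk _ _ hEw, twinRel_mk _ _ hEw']
  in_two p := by
    induction p using Quotient.inductionOn with | h w
    -- the twins of `w` are the in-neighbours of an out-neighbour of `w`
    obtain ⟨z, hz⟩ := h.exists_out w
    obtain ⟨w₁, w₂, hne, h1, h2⟩ := h.in_two z
    have hw1 : Quotient.mk (twinSetoid E) w₁ = Quotient.mk _ w := Quotient.sound (h.twin h1 hz)
    have hw2 : Quotient.mk (twinSetoid E) w₂ = Quotient.mk _ w := Quotient.sound (h.twin h2 hz)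
    obtain ⟨u₁, -, -, hu1, -⟩ := h.in_two w₁
    obtain ⟨u₂, -, -, hu2, -⟩ := h.in_two w₂
    refine ⟨Quotient.mk _ u₁, Quotient.mk _ u₂, fun he => hne ?_, ?_, ?_⟩
    · exact hsep u₁ w₁ w₂ hu1 ((Quotient.exact he w₂).2 hu2) (h.twin h1 h2)
    · exact hw1 ▸ twinRel_mk _ _ hu1
    · exact hw2 ▸ twinRel_mk _ _ hu2
  comm a b p := by
    induction p using Quotient.inductionOn with | h u
    exact congrArg (Quotient.mk _) (h.comm a b u)
  rel a p q := by
    rintro ⟨u, w, hE, rfl, rfl⟩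
    exact twinRel_mk _ _ (h.rel a u w hE)
  out_trans p q q' hq hq' := by
    induction p using Quotient.inductionOn with | h u
    obtain ⟨w, hw, rfl⟩ := exists_of_twinRel_mk hq
    obtain ⟨w', hw', rfl⟩ := exists_of_twinRel_mk hq'
    obtain ⟨a, hau, haw⟩ := h.out_trans u w w' hw hw'
    exact ⟨a, congrArg (Quotient.mk _) hau, congrArg (Quotient.mk _) haw⟩
  in_trans q p p' := by
    rintro ⟨u, w, hE, rfl, rfl⟩ ⟨u', w', hE', rfl, hww'⟩
    obtain ⟨z, hz⟩ := h.exists_out w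
    have hz' : E w' z := (Quotient.exact hww' z).2 hz
    obtain ⟨a, -, haw⟩ := h.in_trans z w w' hz hz'
    refine ⟨a, (congrArg (Quotient.mk _) haw).trans hww', Quotient.sound ?_⟩
    exact h.twin (haw ▸ h.rel a u w hE) hE'
  closed S hS hcl := by
    have := h.closed (Quotient.mk _ ⁻¹' S) (by
      obtain ⟨p, hp⟩ := hS
      induction p using Quotient.inductionOn with | h u
      exact ⟨u, hp⟩) fun u hu w hw => hcl _ hu _ (twinRel_mk u w hw)
    ext p
    induction p using Quotient.inductionOn with | h u
    exact iff_of_true (by simpa using this.ge (Set.mem_univ u)) trivial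
  level p q := by
    rintro ⟨u, w, hE, rfl, rfl⟩
    exact h.level u w hE

/-- If `Q`, the quotient of the digraph by twins, is `C_R(2, t)`, then the digraph, whose vertices
correspond to the arcs of `Q`, is `C_R(2, t + 1)`. -/
theorem exists_equiv_succ (h : LocallyAbelian E φ ℓ)
    (hsep : ∀ u w w', E u w → E u w' → (twinSetoid E).r w w' → w = w') {R t : ℕ}
    (e : Quotient (twinSetoid E) ≃ ZMod R × (Fin t → ZMod 2)) (ht : 1 ≤ t)
    (he : ∀ p q, twinRel E p q ↔ (highlyArcTransitiveDigraph R 2 t).Adj (e p) (e q)) :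
    ∃ e' : X ≃ ZMod R × (Fin (t + 1) → ZMod 2),
      ∀ p q, E p q ↔ (highlyArcTransitiveDigraph R 2 (t + 1)).Adj (e' p) (e' q) := by
  obtain ⟨t, rfl⟩ : ∃ s, t = s + 1 := ⟨t - 1, by omega⟩
  choose inn hinn using fun w => (h.in_two w).imp fun u hu => (hu.choose_spec.2.1 : E u w)
  let m : X → Quotient (twinSetoid E) := Quotient.mk _
  have hstep : ∀ w, (e (m w)).1 = (e (m (inn w))).1 + 1 ∧
      ∀ a : Fin t, (e (m w)).2 a.succ = (e (m (inn w))).2 a.castSucc := by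
    intro w
    have := (he _ _).1 (twinRel_mk _ _ (hinn w))
    exact ⟨this.1, fun a => this.2 _ _ (by simp)⟩
  have hadj : ∀ p q : ZMod R × (Fin (t + 1) → ZMod 2),
      (highlyArcTransitiveDigraph R 2 (t + 1)).Adj p q ↔
      q.1 = p.1 + 1 ∧ ∀ a : Fin t, q.2 a.succ = p.2 a.castSucc := by
    intro p q
    refine ⟨fun h => ⟨h.1, fun a => h.2 _ _ (by simp)⟩, fun h => ⟨h.1, fun a b hab => ?_⟩⟩
    have ha : (a : ℕ) < t := by have := b.2; omega
    have hb : b = Fin.succ ⟨a, ha⟩ := Fin.ext hab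
    rw [hb]
    exact h.2 ⟨a, ha⟩
  let ψ : X → ZMod R × (Fin (t + 1 + 1) → ZMod 2) := fun w =>
    ((e (m w)).1, Fin.snoc (e (m w)).2 ((e (m (inn w))).2 (Fin.last t)))
  have hEψ : ∀ u w, E u w ↔ (highlyArcTransitiveDigraph R 2 (t + 1 + 1)).Adj (ψ u) (ψ w) := by
    intro u w
    have hmain : (highlyArcTransitiveDigraph R 2 (t + 1 + 1)).Adj (ψ u) (ψ w) ↔
        e (m u) = e (m (inn w)) := by
      have hx : (highlyArcTransitiveDigraph R 2 (t + 1 + 1)).Adj (ψ u) (ψ w) ↔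
        (ψ w).1 = (ψ u).1 + 1 ∧ ∀ a : Fin (t + 1), (ψ w).2 a.succ = (ψ u).2 a.castSucc := by
        refine ⟨fun h => ⟨h.1, fun a => h.2 _ _ (by simp)⟩, fun h => ⟨h.1, fun a b hab => ?_⟩⟩
        have ha : (a : ℕ) < t + 1 := by have := b.2; omega
        have hb : b = Fin.succ ⟨a, ha⟩ := Fin.ext hab
        rw [hb]
        exact h.2 ⟨a, ha⟩
      rw [hx]
      simp only [ψ]
      have hval : ∀ a : Fin (t + 1), (Fin.snoc (e (m w)).2 ((e (m (inn w))).2 (Fin.last t)) :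
          Fin (t + 1 + 1) → ZMod 2) a.succ = (e (m (inn w))).2 a := by
        intro a
        refine Fin.lastCases ?_ (fun b => ?_) a
        · rw [Fin.succ_last, Fin.snoc_last]
        · rw [Fin.succ_castSucc, Fin.snoc_castSucc, (hstep w).2]
      constructor
      · rintro ⟨h1, h2⟩
        refine Prod.ext ?_ (funext fun a => ?_)
        · rw [(hstep w).1] at h1
          exact (add_right_cancel h1).symm
        · have := h2 a
          rw [hval, Fin.snoc_castSucc] at this
          exact this.symm
      · intro heq
        refine ⟨by rw [heq]; exact (hstep w).1, fun a => ?_⟩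
        rw [hval, Fin.snoc_castSucc, heq]
    rw [hmain]
    constructor
    · intro hE
      exact congrArg e (Quotient.sound (h.twin hE (hinn w)))
    · intro heq
      exact (Quotient.exact (e.injective heq) w).2 (hinn w)
  have hinj : Function.Injective ψ := by
    intro w w' hw
    have h1 : (ψ w).1 = (ψ w').1 := congrArg Prod.fst hw
    have h2 : (ψ w).2 = (ψ w').2 := congrArg Prod.snd hw
    simp only [ψ] at h1 h2
    have h3 := Fin.snoc_injective2 h2
    have hmw : m w = m w' := e.injective (Prod.ext h1 h3.1)
    have hmi : m (inn w) = m (inn w') := by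
      refine e.injective (Prod.ext ?_ (funext fun a => ?_))
      · have := (hstep w).1
        rw [h1, (hstep w').1] at this
        exact (add_right_cancel this).symm
      · refine Fin.lastCases h3.2 (fun b => ?_) a
        rw [← (hstep w).2, ← (hstep w').2, h3.1]
    exact hsep (inn w) w w' (hinn w) ((Quotient.exact hmi w').2 (hinn w')) (Quotient.exact hmw)
  have hsurj : Function.Surjective ψ := by
    rintro ⟨i, Y⟩
    let y : ZMod R × (Fin (t + 1) → ZMod 2) := (i - 1, fun a => Y a.succ)
    let z : ZMod R × (Fin (t + 1) → ZMod 2) := (i, fun a => Y a.castSucc)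
    have hyz : twinRel E (e.symm y) (e.symm z) := by
      rw [he, hadj]
      simp [y, z]
    obtain ⟨u, w, hE, hu, hw⟩ := hyz
    have hmu : e (m (inn w)) = y := by
      rw [← Equiv.eq_symm_apply, ← hu]
      exact Quotient.sound (h.twin (hinn w) hE)
    have hmw : e (m w) = z := by rw [← Equiv.eq_symm_apply, ← hw]
    refine ⟨w, Prod.ext (by simp [ψ, hmw, z]) ?_⟩
    simp only [ψ, hmw, hmu]
    funext a
    refine Fin.lastCases ?_ (fun b => ?_) a
    · simp [y]
    · simp [z]
  exact ⟨Equiv.ofBijective ψ ⟨hinj, hsurj⟩, hEψ⟩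

/-- If the out-neighbours of a vertex are always twins, the digraph is `C_R(2, 1)`. -/
theorem exists_equiv_one [Finite X] (h : LocallyAbelian E φ ℓ) (hr : 3 ≤ r) (u₀ : X)
    (hall : ∀ u w w', E u w → E u w' → (twinSetoid E).r w w') :
    ∃ R, 3 ≤ R ∧ ∃ e : X ≃ ZMod R × (Fin 1 → ZMod 2),
      ∀ p q, E p q ↔ (highlyArcTransitiveDigraph R 2 1).Adj (e p) (e q) := by
  choose w₀ w₁ hne hw using h.out_two
  have hE0 : ∀ u, E u (w₀ u) := fun u => (hw u _).2 (Or.inl rfl)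
  have hE1 : ∀ u, E u (w₁ u) := fun u => (hw u _).2 (Or.inr rfl)
  -- the twin classes are permuted cyclically
  let s : Quotient (twinSetoid E) → Quotient (twinSetoid E) :=
    Quotient.map w₀ fun a b hab => hall b _ _ ((hab _).1 (hE0 a)) (hE0 b)
  have hs : ∀ u w, E u w → s (Quotient.mk _ u) = Quotient.mk _ w := fun u w hE =>
    Quotient.sound (hall u _ _ (hE0 u) hE)
  have hssurj : Function.Surjective s := by
    intro q
    induction q using Quotient.inductionOn with | h w
    obtain ⟨u, -, -, hu, -⟩ := h.in_two w
    exact ⟨Quotient.mk _ u, hs u w hu⟩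
  let σ : Equiv.Perm (Quotient (twinSetoid E)) :=
    Equiv.ofBijective s ⟨Finite.injective_iff_surjective.2 hssurj, hssurj⟩
  have hσ : ∀ u w, E u w → σ (Quotient.mk _ u) = Quotient.mk _ w := hs
  set p₀ : Quotient (twinSetoid E) := Quotient.mk _ u₀
  have horb : ∀ p, ∃ k : ℤ, (σ ^ k) p₀ = p := by
    have := h.closed {u | ∃ k : ℤ, (σ ^ k) p₀ = Quotient.mk _ u} ⟨u₀, 0, rfl⟩ (by
      rintro u ⟨k, hk⟩ w hE
      exact ⟨1 + k, by rw [zpow_add, zpow_one, Equiv.Perm.mul_apply, hk, hσ u w hE]⟩)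
    intro p
    induction p using Quotient.inductionOn with | h u
    exact this.ge (Set.mem_univ u)
  let R := Function.minimalPeriod (σ • ·) p₀
  have hR : ∀ k j : ℤ, (σ ^ k) p₀ = (σ ^ j) p₀ ↔ (k : ZMod R) = j := by
    intro k j
    rw [ZMod.intCast_eq_intCast_iff_dvd_sub, ← MulAction.zpow_smul_eq_iff_minimalPeriod_dvd,
      sub_eq_neg_add, zpow_add, zpow_neg, mul_smul, inv_smul_eq_iff, eq_comm,
      Equiv.Perm.smul_def, Equiv.Perm.smul_def]
  have hlev : ∀ k : ℤ, h.twinLevel ((σ ^ k) p₀) = h.twinLevel p₀ + k := by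
    have h1 : ∀ p, h.twinLevel (σ p) = h.twinLevel p + 1 := by
      intro p
      induction p using Quotient.inductionOn with | h u
      rw [hσ u _ (hE0 u)]
      exact h.level u _ (hE0 u)
    intro k
    induction k using Int.induction_on with
    | zero => simp
    | succ k ih =>
      rw [add_comm, zpow_add, zpow_one, Equiv.Perm.mul_apply, h1, ih]
      push_cast
      ring
    | pred k ih =>
      have h2 := h1 ((σ ^ (-(k : ℤ) - 1)) p₀)
      rw [← Equiv.Perm.mul_apply, ← zpow_one_add, show 1 + (-(k : ℤ) - 1) = -k by ring, ih] at h2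
      rw [← add_left_inj (1 : ZMod r), ← h2]
      push_cast
      ring
  have hR0 : R ≠ 0 := by
    have : 0 < R := Function.minimalPeriod_pos_of_mem_periodicPts
      (Function.Injective.mem_periodicPts σ.injective p₀)
    omega
  have hR3 : 3 ≤ R := by
    have h1 : (σ ^ (R : ℤ)) p₀ = (σ ^ (0 : ℤ)) p₀ := (hR _ _).2 (by simp)
    have h2 := hlev R
    rw [h1, hlev] at h2
    have h3 : ((R : ℕ) : ZMod r) = 0 := by simpa using h2.symm
    exact hr.trans (Nat.le_of_dvd (Nat.pos_of_ne_zero hR0) ((ZMod.natCast_eq_zero_iff _ _).1 h3))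
  have : NeZero R := ⟨hR0⟩
  let c : ZMod R → Quotient (twinSetoid E) := fun i => (σ ^ (i.val : ℤ)) p₀
  have hc : ∀ k : ℤ, c k = (σ ^ k) p₀ := fun k => (hR _ _).2 (by simp)
  have hcinj : Function.Injective c := fun i j hij => by simpa using (hR _ _).1 hij
  have hcsurj : Function.Surjective c := fun p => by
    obtain ⟨k, rfl⟩ := horb p
    exact ⟨k, hc k⟩
  have hcsucc : ∀ i, σ (c i) = c (i + 1) := by
    intro i
    have h1 := hc ((i.val : ℤ) + 1)
    rw [add_comm (i.val : ℤ), zpow_one_add, Equiv.Perm.mul_apply] at h1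
    rw [show (i + 1 : ZMod R) = ((1 + (i.val : ℤ) : ℤ) : ZMod R) by simp [add_comm], h1]
  let f : ZMod R × (Fin 1 → ZMod 2) → X := fun p =>
    if p.2 0 = 0 then w₀ (c (p.1 - 1)).out else w₁ (c (p.1 - 1)).out
  have hEf : ∀ p, E (c (p.1 - 1)).out (f p) := by
    intro p
    simp only [f]
    split_ifs
    exacts [hE0 _, hE1 _]
  have hmk : ∀ p, Quotient.mk _ (f p) = c p.1 := by
    intro p
    have := hσ _ _ (hEf p)
    rw [Quotient.out_eq, hcsucc, sub_add_cancel] at this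
    exact this.symm
  have hEfiff : ∀ p q, E (f p) (f q) ↔ q.1 = p.1 + 1 := by
    intro p q
    constructor
    · intro hE
      have := hσ _ _ hE
      rw [hmk, hmk, hcsucc] at this
      exact (hcinj this).symm
    · intro hq
      have h1 : Quotient.mk (twinSetoid E) (c (q.1 - 1)).out = Quotient.mk _ (f p) := by
        rw [Quotient.out_eq, hmk, hq, add_sub_cancel_right]
      exact (Quotient.exact h1 _).1 (hEf q)
  have hfbij : Function.Bijective f := by
    constructor
    · rintro ⟨i, x⟩ ⟨j, y⟩ hxy
      have hij : i = j := hcinj (by rw [← hmk (i, x), ← hmk (j, y), hxy])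
      subst hij
      refine Prod.ext rfl (funext fun a => ?_)
      obtain rfl : a = 0 := Subsingleton.elim _ _
      have hz : ∀ z : ZMod 2, z = 0 ∨ z = 1 := by decide
      simp only [f] at hxy
      rcases hz (x 0) with hx | hx <;> rcases hz (y 0) with hy | hy
      · exact hx.trans hy.symm
      · simp [hx, hy, hne] at hxy
      · simp [hx, hy, (hne _).symm] at hxy
      · exact hx.trans hy.symm
    · intro w
      obtain ⟨u, -, -, hu, -⟩ := h.in_two w
      obtain ⟨i, hi⟩ := hcsurj (Quotient.mk _ u)
      have hEw : E (c i).out w := by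
        have h1 : Quotient.mk (twinSetoid E) (c i).out = Quotient.mk _ u := by
          rw [Quotient.out_eq, hi]
        exact (Quotient.exact h1 _).2 hu
      rcases (hw _ _).1 hEw with hw' | hw'
      · exact ⟨(i + 1, fun _ => 0), by simp [f, ← hw']⟩
      · exact ⟨(i + 1, fun _ => 1), by simp [f, ← hw']⟩
  refine ⟨R, hR3, (Equiv.ofBijective f hfbij).symm, fun p q => ?_⟩
  obtain ⟨p, rfl⟩ := (Equiv.ofBijective f hfbij).surjective p
  obtain ⟨q, rfl⟩ := (Equiv.ofBijective f hfbij).surjective q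
  rw [Equiv.symm_apply_apply, Equiv.symm_apply_apply]
  refine (hEfiff p q).trans ⟨fun h => ⟨h, fun a b hab => ?_⟩, fun h => h.1⟩
  omega

/-- A locally abelian digraph is some `C_R(2, t)`: passing to twin classes undoes one step of the
line digraph construction, and the process ends with `C_R(2, 1)`. -/
theorem exists_equiv [Finite X] [Nonempty X] (h : LocallyAbelian E φ ℓ) (hr : 3 ≤ r) :
    ∃ R t, 3 ≤ R ∧ 1 ≤ t ∧ ∃ e : X ≃ ZMod R × (Fin t → ZMod 2),
      ∀ p q, E p q ↔ (highlyArcTransitiveDigraph R 2 t).Adj (e p) (e q) := by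
  induction hn : Nat.card X using Nat.strong_induction_on generalizing X with | _ n ih
  subst hn
  by_cases hsep : ∀ u w w', E u w → E u w' → (twinSetoid E).r w w' → w = w'
  · have hlt : Nat.card (Quotient (twinSetoid E)) < Nat.card X := by
      obtain ⟨u, u', hne, hu, hu'⟩ := h.in_two (Classical.arbitrary X)
      refine lt_of_le_of_ne (Nat.card_le_card_of_surjective _ Quotient.mk_surjective)
        fun he => hne ?_
      have hb := (Nat.bijective_iff_surjective_and_card (Quotient.mk (twinSetoid E))).2
        ⟨Quotient.mk_surjective, he.symm⟩
      exact hb.1 (Quotient.sound (h.twin hu hu'))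
    have : Nonempty (Quotient (twinSetoid E)) := Nonempty.map (Quotient.mk _) inferInstance
    obtain ⟨R, t, hR, ht, e, he⟩ := ih _ hlt (h.twinQuotient hsep) rfl
    obtain ⟨e', he'⟩ := h.exists_equiv_succ hsep e ht he
    exact ⟨R, t + 1, hR, by omega, e', he'⟩
  · push Not at hsep
    obtain ⟨u, w, w', hw, hw', htw, hne⟩ := hsep
    obtain ⟨R, hR, e, he⟩ := h.exists_equiv_one hr u (by
      intro v z z' hz hz'
      obtain ⟨f, hf, rfl⟩ := h.homogeneous u v
      have key : ∀ z, E (f u) z → z = f w ∨ z = f w' := by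
        intro z hz
        obtain ⟨z, rfl⟩ := f.surjective z
        obtain ⟨x, x', -, hx⟩ := h.out_two u
        have h1 := (hx _).1 ((hf _ _).2 hz)
        have h2 := (hx _).1 hw
        have h3 := (hx _).1 hw'
        rw [f.injective.eq_iff, f.injective.eq_iff]
        grind
      have htf := (twin_aut f hf w w').1 htw
      rcases key z hz with rfl | rfl <;> rcases key z' hz' with rfl | rfl
      exacts [(twinSetoid E).refl _, htf, (twinSetoid E).symm htf, (twinSetoid E).refl _])
    exact ⟨R, 1, hR, le_rfl, e, he⟩

end LocallyAbelian
end Shift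
end GraphPair

/-! ### The index of a normal subgroup that is transitive on levels -/

namespace GraphPair

section IndexBound

/-- A group `G` acting faithfully by automorphisms on a strongly connected digraph of out-valency
two, transitively on the vertices, with a level function onto a cycle whose level sets each lie in
one orbit of the subgroup `N`. -/
structure LevelAction {G : Type u} [Group G] (N : Subgroup G) {X : Type u} (E : X → X → Prop)
    (φ : G →* Equiv.Perm X) {r : ℕ} (ℓ : X → ZMod r) : Prop where
  inj : Function.Injective φ
  rel : ∀ g u w, E u w → E (φ g u) (φ g w)
  trans : ∀ u v, ∃ g, φ g u = v
  out_two : ∀ u, ∃ w w', w ≠ w' ∧ ∀ z, E u z ↔ z = w ∨ z = w'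
  closed : ∀ S : Set X, S.Nonempty → (∀ u ∈ S, ∀ w, E u w → w ∈ S) → S = Set.univ
  level : ∀ u w, E u w → ℓ w = ℓ u + 1
  orbit : ∀ u v, ℓ u = ℓ v → ∃ n ∈ N, φ n u = v

namespace LevelAction

variable {G : Type u} [Group G] {N : Subgroup G} {X : Type u} {E : X → X → Prop}
  {φ : G →* Equiv.Perm X} {r : ℕ} {ℓ : X → ZMod r}

theorem card_le [Finite G] [NeZero r] [Nonempty X] (h : LevelAction N E φ ℓ) :
    Nat.card X ≤ r * Nat.card N := by
  classical
  let base : ZMod r → X := fun i => if hi : ∃ u, ℓ u = i then hi.choose else Classical.arbitrary X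
  have hbase : ∀ u, ℓ (base (ℓ u)) = ℓ u := by
    intro u
    have hu : ∃ v, ℓ v = ℓ u := ⟨u, rfl⟩
    simp only [base, dif_pos hu]
    exact hu.choose_spec
  choose n hnN hn using fun u => h.orbit (base (ℓ u)) u (hbase u)
  let f : X → ZMod r × N := fun u => (ℓ u, ⟨n u, hnN u⟩)
  have hf : Function.Injective f := by
    intro u v huv
    simp only [f, Prod.mk.injEq, Subtype.mk.injEq] at huv
    rw [← hn u, ← hn v, huv.1, huv.2]
  calc Nat.card X ≤ Nat.card (ZMod r × N) := Nat.card_le_card_of_injective f hf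
    _ = r * Nat.card N := by rw [Nat.card_prod, Nat.card_zmod]

/-- If `N` acts semiregularly, an element fixing a directed path that meets every level is trivial:
two vertices of a level differ by an element of `N`, which commutes with the given element as soon
as both vertices are fixed. Hence the set of fixed vertices is closed under passing to
out-neighbours. -/
theorem eq_one_of_fixes_path [N.Normal] [NeZero r] (h : LevelAction N E φ ℓ)
    (hreg : ∀ n ∈ N, ∀ v, φ n v = v → n = 1) {p : ℕ → X} (hp : ∀ i, E (p i) (p (i + 1))) {g : G}
    (hg : ∀ i ≤ r, φ g (p i) = p i) : g = 1 := by
  have hlev : ∀ i : ℕ, ℓ (p i) = ℓ (p 0) + i := by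
    intro i
    induction i with
    | zero => simp
    | succ i ih =>
      rw [h.level _ _ (hp i), ih]
      push_cast
      ring
  have hfix : {u | φ g u = u} = Set.univ := by
    refine h.closed _ ⟨p 0, hg 0 (Nat.zero_le _)⟩ fun u hu z hz => ?_
    set j := (ℓ u - ℓ (p 0)).val
    have hj : j < r := ZMod.val_lt _
    have hju : ℓ (p j) = ℓ u := by
      rw [hlev]
      simp [j]
    obtain ⟨n, hn, hnu⟩ := h.orbit _ _ hju
    have hcomm : g * n = n * g := by
      have h1 : n⁻¹ * (g * n * g⁻¹) = 1 := by
        refine hreg _ (N.mul_mem (N.inv_mem hn) (‹N.Normal›.conj_mem n hn g)) (p j) ?_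
        have h2 : φ g⁻¹ (p j) = p j := by
          rw [map_inv, Equiv.Perm.inv_eq_iff_eq, hg j hj.le]
        rw [map_mul, map_mul, map_mul, Equiv.Perm.mul_apply, Equiv.Perm.mul_apply,
          Equiv.Perm.mul_apply, h2, hnu, show φ g u = u from hu, map_inv, Equiv.Perm.inv_eq_iff_eq,
          hnu]
      rw [inv_mul_eq_one] at h1
      rw [eq_comm, ← eq_mul_inv_iff_mul_eq]
      exact h1
    -- `g` fixes `p j` and one of its two out-neighbours, so it fixes the other one
    have hout : ∀ w, E (p j) w → φ g w = w := by
      intro w hw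
      obtain ⟨a, b, -, hab⟩ := h.out_two (p j)
      have h1 := (hab _).1 (hp j)
      have h2 := hg (j + 1) hj
      have h3 := (hab _).1 hw
      have h4 := h.rel g _ _ hw
      rw [hg j hj.le, hab] at h4
      by_cases hw' : w = p (j + 1)
      · rw [hw', h2]
      · have h5 : φ g w ≠ p (j + 1) := fun he => hw' ((φ g).injective (he.trans h2.symm))
        grind
    obtain ⟨z, rfl⟩ := (φ n).surjective z
    have hz' : E (p j) z := by
      have := h.rel n⁻¹ _ _ hz
      rwa [← hnu, ← Equiv.Perm.mul_apply, ← map_mul, ← Equiv.Perm.mul_apply, ← map_mul,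
        inv_mul_cancel, map_one] at this
    change φ g (φ n z) = φ n z
    rw [← Equiv.Perm.mul_apply, ← map_mul, hcomm, map_mul, Equiv.Perm.mul_apply, hout z hz']
  refine h.inj (Equiv.ext fun u => ?_)
  rw [map_one]
  exact hfix.ge (Set.mem_univ u)

theorem index_le_of_semiregular [Finite G] [Finite X] [N.Normal] [NeZero r] [Nonempty X]
    (h : LevelAction N E φ ℓ) (hreg : ∀ n ∈ N, ∀ v, φ n v = v → n = 1) :
    N.index ≤ r * 2 ^ r := by
  choose w₀ w₁ hne hw using h.out_two
  let c : X → Bool → X := fun u b => if b then w₀ u else w₁ u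
  have hc : ∀ u z, E u z → ∃ b, z = c u b := by
    intro u z hz
    rcases (hw u z).1 hz with hz | hz
    exacts [⟨true, hz⟩, ⟨false, hz⟩]
  let p : ℕ → X := fun i => Nat.rec (Classical.arbitrary X) (fun _ u => w₀ u) i
  have hp : ∀ i, E (p i) (p (i + 1)) := fun i => (hw _ _).2 (Or.inl rfl)
  choose b hb using fun (g : G) i => hc _ _ (h.rel g _ _ (hp i))
  -- `g` is determined by the image of the start of the path and the choices made along its image
  let f : G → X × (Fin r → Bool) := fun g => (φ g (p 0), fun i => b g i)
  have hf : Function.Injective f := by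
    intro g g' hgg
    have h0 : φ g (p 0) = φ g' (p 0) := congrArg Prod.fst hgg
    have h1 : ∀ i < r, b g i = b g' i := fun i hi => congrFun (congrArg Prod.snd hgg) ⟨i, hi⟩
    have h2 : ∀ i ≤ r, φ g (p i) = φ g' (p i) := by
      intro i
      induction i with
      | zero => exact fun _ => h0
      | succ i ih =>
        intro hi
        rw [hb, hb, ih (by omega), h1 i (by omega)]
    rw [← inv_mul_eq_one]
    refine h.eq_one_of_fixes_path hreg hp fun i hi => ?_
    rw [map_mul, map_inv, Equiv.Perm.mul_apply, Equiv.Perm.inv_eq_iff_eq, h2 i hi]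
  have hG : Nat.card G ≤ Nat.card X * 2 ^ r := by
    refine (Nat.card_le_card_of_injective f hf).trans ?_
    rw [Nat.card_prod]
    simp [Nat.card_eq_fintype_card]
  have h3 : Nat.card N * N.index ≤ Nat.card N * (r * 2 ^ r) := by
    rw [N.card_mul_index]
    calc Nat.card G ≤ Nat.card X * 2 ^ r := hG
      _ ≤ r * Nat.card N * 2 ^ r := Nat.mul_le_mul_right _ h.card_le
      _ = Nat.card N * (r * 2 ^ r) := by ring
  exact Nat.le_of_mul_le_mul_left h3 Nat.card_pos

/-- The action on the arcs. -/
def arcHom (h : LevelAction N E φ ℓ) : G →* Equiv.Perm {p : X × X // E p.1 p.2} :=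
  MonoidHom.toHomPerm
    { toFun := fun g p => ⟨(φ g p.1.1, φ g p.1.2), h.rel g _ _ p.2⟩
      map_one' := by
        funext p
        simp
        rfl
      map_mul' := fun g g' => by
        funext p
        simp
        rfl }

theorem arcHom_apply (h : LevelAction N E φ ℓ) (g : G) (p : {p : X × X // E p.1 p.2}) :
    (h.arcHom g p).1 = (φ g p.1.1, φ g p.1.2) := rfl

/-- If `N` does not act semiregularly, some element of `N` fixes a vertex and interchanges its
out-neighbours; then `N` is also transitive on the arcs leaving a level, and everything carries
over to the line digraph. -/
theorem line [N.Normal] (h : LevelAction N E φ ℓ) {n : G} (hn : n ∈ N)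
    {v : X} (hv : φ n v = v) (hn1 : n ≠ 1) :
    LevelAction N (fun p q : {p : X × X // E p.1 p.2} => p.1.2 = q.1.1) h.arcHom
      (fun p => ℓ p.1.1) := by
  obtain ⟨u₀, hu₀, z₀, hz₀, hne⟩ : ∃ u, φ n u = u ∧ ∃ z, E u z ∧ φ n z ≠ z := by
    by_contra! hcon
    have := h.closed {u | φ n u = u} ⟨v, hv⟩ fun u hu w hw => hcon u hu w hw
    refine hn1 (h.inj (Equiv.ext fun u => ?_))
    rw [map_one]
    exact this.ge (Set.mem_univ u)
  have hswap : ∀ u w w', E u w → E u w' → ∃ m ∈ N, φ m u = u ∧ φ m w = w' := by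
    intro u w w' hw hw'
    by_cases hww : w = w'
    · exact ⟨1, N.one_mem, by simp, by simp [hww]⟩
    obtain ⟨g, rfl⟩ := h.trans u₀ u
    refine ⟨g * n * g⁻¹, ‹N.Normal›.conj_mem n hn g, by simp [hu₀], ?_⟩
    have key : ∀ z, φ (g * n * g⁻¹) (φ g z) = φ g (φ n z) := by simp
    obtain ⟨a, b, -, hab⟩ := h.out_two (φ g u₀)
    have h1 := (hab _).1 (h.rel g _ _ hz₀)
    have h2 := (hab _).1 (h.rel g _ _ (hu₀ ▸ h.rel n _ _ hz₀ : E u₀ (φ n z₀)))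
    have h3 := (hab _).1 hw
    have h4 := (hab _).1 hw'
    have h5 : φ g z₀ ≠ φ g (φ n z₀) := fun he => hne ((φ g).injective he).symm
    have h6 := h.rel (g * n * g⁻¹) _ _ hw
    have h7 := h.rel (g * n * g⁻¹) _ _ (h.rel g _ _ hz₀)
    rw [key, hu₀, hab] at h7
    have h8 : φ (g * n * g⁻¹) (φ g u₀) = φ g u₀ := by rw [key, hu₀]
    rw [h8, hab] at h6
    have h9 := key z₀
    have h10 : φ (g * n * g⁻¹) w ≠ w := by
      intro he
      by_cases hwz : w = φ g z₀
      · rw [hwz, key] at he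
        exact h5 he.symm
      · -- then `w` is the image of `z₀` under the permutation, which is injective
        have : φ (g * n * g⁻¹) (φ g z₀) = w := by grind
        exact hwz ((φ (g * n * g⁻¹)).injective (he.trans this.symm))
    grind
  have horbit : ∀ p q : {p : X × X // E p.1 p.2}, ℓ p.1.1 = ℓ q.1.1 →
      ∃ m ∈ N, h.arcHom m p = q := by
    rintro ⟨⟨u, w⟩, hE⟩ ⟨⟨u', w'⟩, hE'⟩ hl
    obtain ⟨m, hm, rfl⟩ := h.orbit u u' hl
    obtain ⟨m', hm', h1, h2⟩ := hswap _ _ w' (h.rel m _ _ hE) hE'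
    refine ⟨m' * m, N.mul_mem hm' hm, Subtype.ext ?_⟩
    rw [arcHom_apply]
    simp [h1, h2]
  have hout : ∀ u, ∃ w, E u w := fun u => by
    obtain ⟨a, b, -, hab⟩ := h.out_two u
    exact ⟨a, (hab a).2 (Or.inl rfl)⟩
  refine ⟨?_, ?_, ?_, ?_, ?_, ?_, horbit⟩
  · intro g g' hgg
    refine h.inj (Equiv.ext fun u => ?_)
    obtain ⟨w, hw⟩ := hout u
    have := congrArg Subtype.val (DFunLike.congr_fun hgg ⟨(u, w), hw⟩)
    rw [arcHom_apply, arcHom_apply] at this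
    exact congrArg Prod.fst this
  · intro g p q hpq
    exact congrArg (φ g) hpq
  · intro p q
    obtain ⟨g, hg⟩ := h.trans p.1.1 q.1.1
    obtain ⟨m, -, hm⟩ := horbit (h.arcHom g p) q (congrArg ℓ hg)
    exact ⟨m * g, by rw [map_mul, Equiv.Perm.mul_apply, hm]⟩
  · rintro ⟨⟨u, w⟩, hE⟩
    obtain ⟨a, b, hne, hab⟩ := h.out_two w
    refine ⟨⟨(w, a), (hab a).2 (Or.inl rfl)⟩, ⟨(w, b), (hab b).2 (Or.inr rfl)⟩, ?_, ?_⟩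
    · simpa using hne
    · rintro ⟨⟨w', z⟩, hE'⟩
      simp only [Subtype.mk.injEq, Prod.mk.injEq]
      constructor
      · rintro rfl
        rcases (hab z).1 hE' with rfl | rfl <;> simp
      · rintro (⟨h, -⟩ | ⟨h, -⟩) <;> exact h.symm
  · intro S hS hcl
    -- the heads of the arcs in `S` form a closed set of vertices
    have hT := h.closed {w | ∃ p ∈ S, p.1.2 = w} (by
      obtain ⟨p, hp⟩ := hS
      exact ⟨_, p, hp, rfl⟩) (by
      rintro _ ⟨p, hp, rfl⟩ z hz
      exact ⟨⟨(p.1.2, z), hz⟩, hcl p hp _ rfl, rfl⟩)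
    ext q
    refine iff_of_true ?_ trivial
    obtain ⟨p, hp, hpq⟩ := hT.ge (Set.mem_univ q.1.1)
    exact hcl p hp q hpq
  · rintro ⟨⟨u, w⟩, hE⟩ ⟨⟨w', z⟩, hE'⟩ hpq
    obtain rfl : w = w' := hpq
    exact h.level _ _ hE

theorem index_le [Finite G] [Finite X] [N.Normal] [NeZero r] [Nonempty X]
    (h : LevelAction N E φ ℓ) : N.index ≤ r * 2 ^ r := by
  induction hm : r * Nat.card N - Nat.card X using Nat.strong_induction_on generalizing X with
  | _ m ih
  subst hm
  by_cases hreg : ∀ n ∈ N, ∀ v, φ n v = v → n = 1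
  · exact h.index_le_of_semiregular hreg
  push Not at hreg
  obtain ⟨n, hn, v, hv, hn1⟩ := hreg
  have h' := h.line hn hv hn1
  obtain ⟨a, b, hab, hE⟩ := h.out_two v
  have hEa := (hE a).2 (Or.inl rfl)
  have hEb := (hE b).2 (Or.inr rfl)
  have : Nonempty {p : X × X // E p.1 p.2} := ⟨⟨(v, a), hEa⟩⟩
  have hsurj : Function.Surjective fun p : {p : X × X // E p.1 p.2} => p.1.1 := by
    intro u
    obtain ⟨w, w', -, hw⟩ := h.out_two u
    exact ⟨⟨(u, w), (hw w).2 (Or.inl rfl)⟩, rfl⟩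
  have hlt : Nat.card X < Nat.card {p : X × X // E p.1 p.2} := by
    refine lt_of_le_of_ne (Nat.card_le_card_of_surjective _ hsurj) fun he => hab ?_
    have hb := (Nat.bijective_iff_surjective_and_card _).2 ⟨hsurj, he.symm⟩
    have := hb.1 (a₁ := ⟨(v, a), hEa⟩) (a₂ := ⟨(v, b), hEb⟩) rfl
    simpa using this
  have hle := h'.card_le
  exact ih _ (by omega) h' rfl

end LevelAction
end IndexBound
end GraphPair

/-! ### Groups acting on an oriented graph with a cyclic quotient -/

namespace GraphPair

section Levels

theorem zmod_forall_of_succ {r : ℕ} [NeZero r] {P : ZMod r → Prop} {i : ZMod r} (h0 : P i)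
    (hs : ∀ j, P j → P (j + 1)) (j : ZMod r) : P j := by
  have h : ∀ n : ℕ, P (i + n) := by
    intro n
    induction n with
    | zero => simpa using h0
    | succ n ih =>
      have := hs _ ih
      push_cast
      rwa [← add_assoc]
  simpa using h (j - i).val

theorem zmod_two_ne_zero {r : ℕ} (hr : 3 ≤ r) : (2 : ZMod r) ≠ 0 := by
  intro h
  have h' : ((2 : ℕ) : ZMod r) = 0 := by exact_mod_cast h
  have := Nat.le_of_dvd (by norm_num) ((ZMod.natCast_eq_zero_iff 2 r).1 h')
  omega

/-- Automorphisms of the cycle are affine. -/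
theorem zmod_affine_of_injective {r : ℕ} (hr : 3 ≤ r) {π : ZMod r → ZMod r}
    (hπ : Function.Injective π) (hstep : ∀ i, π (i + 1) = π i + 1 ∨ π (i + 1) = π i - 1) :
    ∃ ε, (ε = 1 ∨ ε = -1) ∧ ∀ i, π i = ε * i + π 0 := by
  have : NeZero r := ⟨by omega⟩
  have h2 := zmod_two_ne_zero hr
  have hne : ∀ i, π (i + 1 + 1) ≠ π i := fun i he => h2 (by
    have := hπ he
    linear_combination this)
  obtain ⟨ε, hε, h0⟩ : ∃ ε, (ε = 1 ∨ ε = -1) ∧ π (0 + 1) = π 0 + ε := by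
    rcases hstep 0 with h | h
    exacts [⟨1, Or.inl rfl, h⟩, ⟨-1, Or.inr rfl, by rw [h]; ring⟩]
  have hall : ∀ i, π (i + 1) = π i + ε := by
    refine zmod_forall_of_succ (i := 0) h0 fun j hj => ?_
    have h1 := hne j
    rcases hstep (j + 1) with h | h <;> rcases hε with rfl | rfl
    · exact h
    · exact absurd (by rw [h, hj]; ring) h1
    · exact absurd (by rw [h, hj]; ring) h1
    · rw [h]; ring
  refine ⟨ε, hε, zmod_forall_of_succ (i := 0) (by simp) fun j hj => ?_⟩
  rw [hall, hj]
  ring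

variable {V G : Type u} [Group G] [MulAction G V]

variable (G) in
/-- A faithful action of `G` by automorphisms of a strongly connected asymmetric digraph `E` of
in- and out-valency two, transitive on the vertices and on the arcs: an orientation of a member
of `OG(4)`. -/
structure OrientedAction (E : V → V → Prop) : Prop where
  faithful : ∀ g : G, (∀ v : V, g • v = v) → g = 1
  rel : ∀ (g : G) u w, E u w → E (g • u) (g • w)
  trans : ∀ u v : V, ∃ g : G, g • u = v
  arc_trans : ∀ u w u' w', E u w → E u' w' → ∃ g : G, g • u = u' ∧ g • w = w'
  asymm : ∀ u w, E u w → ¬ E w u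
  out_two : ∀ u, ∃ w w', w ≠ w' ∧ ∀ z, E u z ↔ z = w ∨ z = w'
  in_two : ∀ w, ∃ u u', u ≠ u' ∧ E u w ∧ E u' w
  closed : ∀ S : Set V, S.Nonempty → (∀ u ∈ S, ∀ w, E u w → w ∈ S) → S = Set.univ

/-- The level sets of `ℓ` are the orbits of `N`, and `ℓ` identifies the graph induced on the set of
orbits with the cycle on `ℤ_r`. -/
structure CycleLevel (N : Subgroup G) (E : V → V → Prop) {r : ℕ} (ℓ : V → ZMod r) : Prop where
  three_le : 3 ≤ r
  orbit : ∀ u v, ℓ u = ℓ v ↔ ∃ n ∈ N, n • u = v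
  adj : ∀ u w, E u w → ℓ w = ℓ u + 1 ∨ ℓ w = ℓ u - 1
  succ : ∀ i, ∃ u w, (E u w ∨ E w u) ∧ ℓ u = i ∧ ℓ w = i + 1

/-- Every arc goes one level up. -/
def LevelOriented (E : V → V → Prop) {r : ℕ} (ℓ : V → ZMod r) : Prop :=
  ∀ u w, E u w → ℓ w = ℓ u + 1

/-- Every vertex has an arc going one level up and an arc going one level down. -/
def LevelUnoriented (E : V → V → Prop) {r : ℕ} (ℓ : V → ZMod r) : Prop :=
  ∀ u, ∃ w w', E u w ∧ E u w' ∧ ℓ w = ℓ u + 1 ∧ ℓ w' = ℓ u - 1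

namespace OrientedAction

variable {E : V → V → Prop}

theorem rel_iff (h : OrientedAction G E) (g : G) (u w : V) : E (g • u) (g • w) ↔ E u w :=
  ⟨fun hE => by simpa using h.rel g⁻¹ _ _ hE, h.rel g u w⟩

theorem ext_of_smul (h : OrientedAction G E) {g g' : G} (hg : ∀ v : V, g • v = g' • v) :
    g = g' := by
  rw [← inv_mul_eq_one]
  refine h.faithful _ fun v => ?_
  rw [mul_smul, ← hg, inv_smul_smul]

theorem exists_out (h : OrientedAction G E) (u : V) : ∃ w, E u w := by
  obtain ⟨w, w', -, hw⟩ := h.out_two u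
  exact ⟨w, (hw w).2 (Or.inl rfl)⟩

/-- Vertex stabilisers are `2`-groups: if `g` fixes a vertex, `g ^ 2` fixes its out-neighbours. -/
theorem exists_pow_eq_one [Finite V] (h : OrientedAction G E) {g : G} {v : V} (hv : g • v = v) :
    ∃ a, g ^ 2 ^ a = 1 := by
  have hall : {w : V | ∃ a, g ^ 2 ^ a • w = w} = Set.univ := by
    refine h.closed _ ⟨v, 0, by simpa using hv⟩ ?_
    rintro u ⟨a, ha⟩ w hw
    refine ⟨a + 1, ?_⟩
    obtain ⟨x, y, -, hxy⟩ := h.out_two u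
    have h1 := (hxy _).1 hw
    have h2 := h.rel (g ^ 2 ^ a) _ _ hw
    rw [ha, hxy] at h2
    have h3 := h.rel (g ^ 2 ^ a) _ _ ((hxy _).2 h2)
    rw [ha, hxy] at h3
    rw [pow_succ, pow_mul, pow_two, mul_smul]
    by_cases hw2 : g ^ 2 ^ a • w = w
    · rw [hw2, hw2]
    · have h4 : g ^ 2 ^ a • g ^ 2 ^ a • w ≠ g ^ 2 ^ a • w := fun he => hw2 (smul_left_cancel _ he)
      grind
  choose a ha using fun w => hall.ge (Set.mem_univ w)
  obtain ⟨b, hb⟩ := (Set.finite_range a).bddAbove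
  refine ⟨b, h.faithful _ fun w => ?_⟩
  have hle : a w ≤ b := hb ⟨w, rfl⟩
  obtain ⟨c, rfl⟩ := Nat.exists_eq_add_of_le hle
  rw [pow_add, pow_mul]
  have : ∀ n : ℕ, (g ^ 2 ^ a w) ^ n • w = w := by
    intro n
    induction n with
    | zero => simp
    | succ n ih => rw [pow_succ, mul_smul, ha, ih]
  exact this _

end OrientedAction

namespace CycleLevel

variable {E : V → V → Prop} {N : Subgroup G} {r : ℕ} {ℓ : V → ZMod r}

theorem neZero (hl : CycleLevel N E ℓ) : NeZero r := ⟨by have := hl.three_le; omega⟩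

theorem two_ne_zero (hl : CycleLevel N E ℓ) : (2 : ZMod r) ≠ 0 :=
  zmod_two_ne_zero hl.three_le

theorem surjective (hl : CycleLevel N E ℓ) (i : ZMod r) : ∃ u, ℓ u = i := by
  obtain ⟨u, -, -, hu, -⟩ := hl.succ i
  exact ⟨u, hu⟩

theorem neg (hl : CycleLevel N E ℓ) : CycleLevel N E (fun v => -ℓ v) where
  three_le := hl.three_le
  orbit u v := by rw [neg_inj, hl.orbit]
  adj u w hE := by
    rcases hl.adj u w hE with h | h
    · right; rw [h]; ring
    · left; rw [h]; ring
  succ i := by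
    obtain ⟨u, w, hE, hu, hw⟩ := hl.succ (-i - 1)
    exact ⟨w, u, hE.symm, by rw [hw]; ring, by rw [hu]; ring⟩

theorem smul_congr [N.Normal] (hl : CycleLevel N E ℓ) (g : G) {u v : V} (h : ℓ u = ℓ v) :
    ℓ (g • u) = ℓ (g • v) := by
  obtain ⟨n, hn, rfl⟩ := (hl.orbit _ _).1 h
  exact (hl.orbit _ _).2 ⟨g * n * g⁻¹, ‹N.Normal›.conj_mem n hn g, by simp [mul_smul]⟩

theorem affine [N.Normal] (h : OrientedAction G E) (hl : CycleLevel N E ℓ) (g : G) :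
    ∃ ε c, (ε = 1 ∨ ε = -1) ∧ ∀ v, ℓ (g • v) = ε * ℓ v + c := by
  choose rep hrep using hl.surjective
  have hval : ∀ v, ℓ (g • rep (ℓ v)) = ℓ (g • v) := fun v => hl.smul_congr g (hrep _)
  obtain ⟨ε, hε, hπ⟩ := zmod_affine_of_injective hl.three_le (π := fun i => ℓ (g • rep i)) (by
    intro i j hij
    have := hl.smul_congr g⁻¹ hij
    rwa [inv_smul_smul, inv_smul_smul, hrep, hrep] at this) (by
    intro i
    obtain ⟨u, w, hE, hu, hw⟩ := hl.succ i
    rw [← hw, ← hu]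
    simp only [hval]
    rcases hE with hE | hE
    · exact hl.adj _ _ (h.rel g _ _ hE)
    · rcases hl.adj _ _ (h.rel g _ _ hE) with h | h
      · right; rw [h]; ring
      · left; rw [h]; ring)
  exact ⟨ε, _, hε, fun v => by rw [← hval, hπ]⟩

theorem affine_unique (hl : CycleLevel N E ℓ) {ε c ε' c' : ZMod r}
    (h : ∀ v, ε * ℓ v + c = ε' * ℓ v + c') : ε = ε' ∧ c = c' := by
  obtain ⟨u, hu⟩ := hl.surjective 0
  obtain ⟨w, hw⟩ := hl.surjective 1
  have h0 := h u
  have h1 := h w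
  rw [hu] at h0
  rw [hw] at h1
  have hc : c = c' := by linear_combination h0
  exact ⟨by linear_combination h1 - hc, hc⟩

/-- If the out-neighbours of each vertex lie in one level and some arc goes up, so do all arcs:
descending along the cycle, the edges between two consecutive levels cannot be arcs going down. -/
theorem levelOriented_of_eq [N.Normal] (h : OrientedAction G E) (hl : CycleLevel N E ℓ)
    (hsame : ∀ v w w', E v w → E v w' → ℓ w = ℓ w') {u z : V} (hE : E u z) (hz : ℓ z = ℓ u + 1) :
    LevelOriented E ℓ := by
  have := hl.neZero
  have key : ∀ u z, E u z → ℓ z = ℓ u + 1 → ∀ v w, ℓ u = ℓ v → E v w → ℓ w = ℓ v + 1 := by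
    intro u z hE hz v w huv hw
    obtain ⟨n, hn, rfl⟩ := (hl.orbit _ _).1 huv
    rw [hsame _ _ _ hw (h.rel n _ _ hE), ← huv, ← hz]
    exact ((hl.orbit _ _).2 ⟨n, hn, rfl⟩).symm
  have hall : ∀ i : ZMod r, ∀ v w, ℓ v = -i → E v w → ℓ w = ℓ v + 1 := by
    refine zmod_forall_of_succ (i := -ℓ u) (fun v w hv hw => key u z hE hz v w (by simp [hv]) hw) ?_
    intro j hj v w hv hw
    obtain ⟨a, b, hab, ha, hb⟩ := hl.succ (-(j + 1))
    have hb' : ℓ b = -j := by rw [hb]; ring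
    rcases hab with hab | hab
    · exact key a b hab (by rw [hb, ha]) v w (by rw [ha, hv]) hw
    · have := hj b a hb' hab
      rw [ha, hb] at this
      exact absurd (by linear_combination -this) hl.two_ne_zero
  exact fun v w hw => hall (-ℓ v) v w (by simp) hw

/-- Up to reversing the cycle, either every arc goes one level up, or every vertex has an arc going
up and an arc going down. -/
theorem dichotomy [N.Normal] (h : OrientedAction G E) (hl : CycleLevel N E ℓ) :
    LevelOriented E ℓ ∨ LevelOriented E (fun v => -ℓ v) ∨ LevelUnoriented E ℓ := by
  by_cases hsame : ∀ v w w', E v w → E v w' → ℓ w = ℓ w'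
  · obtain ⟨u, -⟩ := hl.surjective 0
    obtain ⟨z, hz⟩ := h.exists_out u
    rcases hl.adj u z hz with hlz | hlz
    · exact Or.inl (hl.levelOriented_of_eq h hsame hz hlz)
    · refine Or.inr (Or.inl (hl.neg.levelOriented_of_eq h
        (fun v w w' h1 h2 => by rw [hsame v w w' h1 h2]) hz ?_))
      rw [hlz]
      ring
  · right; right
    push Not at hsame
    obtain ⟨u, w, w', hw, hw', hne⟩ := hsame
    obtain ⟨x, y, hx, hy, hxy⟩ : ∃ x y, E u x ∧ E u y ∧ ℓ x = ℓ u + 1 ∧ ℓ y = ℓ u - 1 := by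
      rcases hl.adj _ _ hw with h1 | h1 <;> rcases hl.adj _ _ hw' with h2 | h2
      · exact absurd (h1.trans h2.symm) hne
      · exact ⟨w, w', hw, hw', h1, h2⟩
      · exact ⟨w', w, hw', hw, h2, h1⟩
      · exact absurd (h1.trans h2.symm) hne
    intro v
    obtain ⟨g, rfl⟩ := h.trans u v
    obtain ⟨ε, c, hε, hg⟩ := hl.affine h g
    rcases hε with rfl | rfl
    · exact ⟨g • x, g • y, h.rel g _ _ hx, h.rel g _ _ hy, by rw [hg, hg, hxy.1]; ring,
        by rw [hg, hg, hxy.2]; ring⟩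
    · exact ⟨g • y, g • x, h.rel g _ _ hy, h.rel g _ _ hx, by rw [hg, hg, hxy.2]; ring,
        by rw [hg, hg, hxy.1]; ring⟩

theorem exists_rotation_of_levelOriented [N.Normal] (h : OrientedAction G E)
    (hl : CycleLevel N E ℓ) (ho : LevelOriented E ℓ) (g : G) : ∃ c, ∀ v, ℓ (g • v) = ℓ v + c := by
  obtain ⟨ε, c, -, hg⟩ := hl.affine h g
  obtain ⟨u, -⟩ := hl.surjective 0
  obtain ⟨w, hw⟩ := h.exists_out u
  have h1 := ho _ _ (h.rel g _ _ hw)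
  rw [hg, hg, ho _ _ hw] at h1
  have : ε = 1 := by linear_combination h1
  exact ⟨c, fun v => by rw [hg, this, one_mul]⟩

theorem exists_smul_eq_add_of_levelOriented [N.Normal] (h : OrientedAction G E)
    (hl : CycleLevel N E ℓ) (ho : LevelOriented E ℓ) (c : ZMod r) :
    ∃ g : G, ∀ v, ℓ (g • v) = ℓ v + c := by
  obtain ⟨u, hu⟩ := hl.surjective 0
  obtain ⟨w, hw⟩ := hl.surjective c
  obtain ⟨g, rfl⟩ := h.trans u w
  obtain ⟨d, hd⟩ := hl.exists_rotation_of_levelOriented h ho g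
  have : d = c := by rw [← hw, hd, hu, zero_add]
  exact ⟨g, this ▸ hd⟩

theorem exists_affine_of_levelUnoriented [N.Normal] (h : OrientedAction G E)
    (hl : CycleLevel N E ℓ) (hu : LevelUnoriented E ℓ) {ε : ZMod r} (hε : ε = 1 ∨ ε = -1)
    (c : ZMod r) : ∃ g : G, ∀ v, ℓ (g • v) = ε * ℓ v + c := by
  obtain ⟨u, hu0⟩ := hl.surjective 0
  obtain ⟨v, hv⟩ := hl.surjective c
  obtain ⟨w, -, hw, -, hw1, -⟩ := hu u
  obtain ⟨z, hz, hz1⟩ : ∃ z, E v z ∧ ℓ z = ε + c := by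
    obtain ⟨z, z', hz, hz', h1, h2⟩ := hu v
    rcases hε with rfl | rfl
    · exact ⟨z, hz, by rw [h1, hv]; ring⟩
    · exact ⟨z', hz', by rw [h2, hv]; ring⟩
  obtain ⟨g, rfl, rfl⟩ := h.arc_trans u w v z hw hz
  obtain ⟨ε', c', -, hg⟩ := hl.affine h g
  have h1 : c' = c := by rw [← hv, hg, hu0]; ring
  rw [hg, hw1, hu0] at hz1
  have h2 : ε' = ε := by linear_combination hz1 - h1
  exact ⟨g, h1 ▸ h2 ▸ hg⟩

theorem exists_smul_eq_add_one [N.Normal] (h : OrientedAction G E) (hl : CycleLevel N E ℓ) :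
    ∃ g : G, ∀ v, ℓ (g • v) = ℓ v + 1 := by
  rcases hl.dichotomy h with ho | ho | hu
  · exact hl.exists_smul_eq_add_of_levelOriented h ho 1
  · obtain ⟨g, hg⟩ := hl.neg.exists_smul_eq_add_of_levelOriented h ho (-1)
    exact ⟨g, fun v => by linear_combination -hg v⟩
  · simpa using hl.exists_affine_of_levelUnoriented h hu (Or.inl rfl) 1

/-- In the unoriented case an element fixing every level and a vertex fixes the two out-neighbours
of that vertex, which lie in different levels; so it is trivial. -/
theorem eq_one_of_levelUnoriented (h : OrientedAction G E) (hl : CycleLevel N E ℓ)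
    (hu : LevelUnoriented E ℓ) {g : G} (hg : ∀ v, ℓ (g • v) = ℓ v) {v : V} (hv : g • v = v) :
    g = 1 := by
  have hall : {w : V | g • w = w} = Set.univ := by
    refine h.closed _ ⟨v, hv⟩ fun u hgu w hw => ?_
    obtain ⟨x, y, hx, hy, hlx, hly⟩ := hu u
    have hxy : ℓ x ≠ ℓ y := by
      rw [hlx, hly]
      exact fun he => hl.two_ne_zero (by linear_combination he)
    obtain ⟨a, b, -, hab⟩ := h.out_two u
    have h1 := h.rel g _ _ hw
    rw [show g • u = u from hgu, hab] at h1
    rw [hab] at hw hx hy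
    have h2 := hg w
    change g • w = w
    grind
  exact h.faithful g fun w => hall.ge (Set.mem_univ w)

/-- The types of two cycles agree when the levels of one refine those of the other. -/
theorem not_levelUnoriented_of_refine [N.Normal] (hl : CycleLevel N E ℓ)
    (ho : LevelOriented E ℓ) {M : Subgroup G} {s : ℕ} {ℓ' : V → ZMod s} (hl' : CycleLevel M E ℓ')
    (href : ∀ u v, ℓ u = ℓ v → ℓ' u = ℓ' v) : ¬ LevelUnoriented E ℓ' := by
  intro hu
  obtain ⟨u, -⟩ := hl.surjective 0
  obtain ⟨w, w', hw, hw', h1, h2⟩ := hu u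
  have := href w w' (by rw [ho _ _ hw, ho _ _ hw'])
  rw [h1, h2] at this
  exact hl'.two_ne_zero (by linear_combination this)

theorem not_levelOriented_of_refine [N.Normal] (hl : CycleLevel N E ℓ)
    (hu : LevelUnoriented E ℓ) {M : Subgroup G} {s : ℕ} {ℓ' : V → ZMod s} (hl' : CycleLevel M E ℓ')
    (href : ∀ u v, ℓ u = ℓ v → ℓ' u = ℓ' v) : ¬ LevelOriented E ℓ' := by
  intro ho
  obtain ⟨u, -⟩ := hl.surjective 0
  obtain ⟨w, -, hw, -, h1, -⟩ := hu u
  obtain ⟨-, z, -, hz, -, h2⟩ := hu w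
  have := href z u (by rw [h2, h1]; ring)
  rw [ho _ _ hz, ho _ _ hw] at this
  exact hl'.two_ne_zero (by linear_combination this)

/-! ### The kernel of the action on the cycle -/

/-- A minimal normal subgroup meeting the kernel of the action on the cycle trivially acts on the
cycle by rotations: a nontrivial commutator of a reflection with a rotation is a rotation. So its
nontrivial elements fix no level. -/
theorem eq_one_of_inf_eq_bot [N.Normal] (h : OrientedAction G E) (hl : CycleLevel N E ℓ)
    {K : Subgroup G} (hK : ∀ g, g ∈ K ↔ ∀ v, ℓ (g • v) = ℓ v) {M : Subgroup G}
    (hM : IsMinimalNormal M) (hMK : M ⊓ K = ⊥) {m : G} (hm : m ∈ M) {v : V}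
    (hmv : ℓ (m • v) = ℓ v) : m = 1 := by
  let R : Subgroup G :=
    { carrier := {g | ∃ c, ∀ v, ℓ (g • v) = ℓ v + c}
      one_mem' := ⟨0, by simp⟩
      mul_mem' := by
        rintro a b ⟨c, hc⟩ ⟨d, hd⟩
        exact ⟨d + c, fun v => by rw [mul_smul, hc, hd, add_assoc]⟩
      inv_mem' := by
        rintro a ⟨c, hc⟩
        refine ⟨-c, fun v => ?_⟩
        have := hc (a⁻¹ • v)
        rw [smul_inv_smul] at this
        rw [this]
        ring }
  have hR : R.Normal := by
    refine ⟨?_⟩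
    rintro a ⟨c, hc⟩ g
    obtain ⟨ε, d, -, hg⟩ := hl.affine h g
    refine ⟨ε * c, fun v => ?_⟩
    have := hg (g⁻¹ • v)
    rw [smul_inv_smul] at this
    rw [mul_smul, mul_smul, hg, hc, this]
    ring
  have hMR : M ≤ R := by
    refine (hM.le_or_inf_eq_bot hR).resolve_right fun hbot => ?_
    obtain ⟨⟨a, ha⟩, ha1⟩ := Subgroup.ne_bot_iff_exists_ne_one.1 hM.2.1
    obtain ⟨ε, c, hε, hac⟩ := hl.affine h a
    have haR : a ∉ R := fun haR => ha1 (Subtype.ext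
      (Subgroup.mem_bot.1 (hbot ▸ (⟨ha, haR⟩ : a ∈ M ⊓ R))))
    have hε' : ε = -1 := hε.resolve_left fun he => haR ⟨c, by simpa [he] using hac⟩
    obtain ⟨g, hg⟩ := hl.exists_smul_eq_add_one h
    have hx : ∀ v, ℓ ((g * a * g⁻¹ * a⁻¹) • v) = ℓ v + 2 := by
      intro v
      have h1 := hg (g⁻¹ • a⁻¹ • v)
      have h2 := hac (a⁻¹ • v)
      rw [smul_inv_smul] at h1 h2
      rw [mul_smul, mul_smul, mul_smul, hg, hac, hε', h2, hε']
      rw [h2, hε'] at *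
      linear_combination h1
    have hmem : g * a * g⁻¹ * a⁻¹ ∈ M ⊓ R :=
      ⟨M.mul_mem (hM.1.conj_mem a ha g) (M.inv_mem ha), 2, hx⟩
    rw [hbot, Subgroup.mem_bot] at hmem
    have := hx v
    rw [hmem, one_smul] at this
    exact hl.two_ne_zero (by linear_combination -this)
  obtain ⟨c, hc⟩ := hMR hm
  have hc0 : c = 0 := by
    have := hc v
    rw [hmv] at this
    linear_combination -this
  rw [← Subgroup.mem_bot, ← hMK]
  exact ⟨hm, (hK m).2 fun w => by rw [hc, hc0, add_zero]⟩

/-- A level has at least two vertices, as a vertex has more than two neighbours. -/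
theorem exists_ne_same_level [N.Normal] (h : OrientedAction G E) (hl : CycleLevel N E ℓ) (u : V) :
    ∃ v, v ≠ u ∧ ℓ v = ℓ u := by
  obtain ⟨u₁, u₂, hne, h1, h2⟩ := h.in_two u
  obtain ⟨w, hw⟩ := h.exists_out u
  have hw1 : w ≠ u₁ := fun he => h.asymm _ _ h1 (he ▸ hw)
  have hw2 : w ≠ u₂ := fun he => h.asymm _ _ h2 (he ▸ hw)
  obtain ⟨x, y, hxy, hlxy⟩ : ∃ x y, x ≠ y ∧ ℓ x = ℓ y := by
    by_contra! hcon
    have e1 := hcon _ _ hne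
    have e2 := hcon _ _ hw1
    have e3 := hcon _ _ hw2
    have a1 := hl.adj _ _ h1
    have a2 := hl.adj _ _ h2
    have a3 := hl.adj _ _ hw
    have a1' : ℓ u₁ = ℓ u - 1 ∨ ℓ u₁ = ℓ u + 1 := by
      rcases a1 with a | a <;> rw [a] <;> simp
    have a2' : ℓ u₂ = ℓ u - 1 ∨ ℓ u₂ = ℓ u + 1 := by
      rcases a2 with a | a <;> rw [a] <;> simp
    grind
  obtain ⟨g, rfl⟩ := h.trans x u
  exact ⟨g • y, fun he => hxy (smul_left_cancel _ he).symm, (hl.smul_congr g hlxy).symm⟩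

/-- If the nontrivial elements of `M` fix no level and `M` has two orbits, then some arc joins
vertices of one orbit: otherwise all neighbours of a vertex lie in the same orbit, and of three
neighbours two lie in the same level. -/
theorem not_two_orbits (h : OrientedAction G E) (hl : CycleLevel N E ℓ) {M : Subgroup G}
    (hM : ∀ m ∈ M, ∀ v, ℓ (m • v) = ℓ v → m = 1) (u : V)
    (htwo : ∀ a b c : V, (∃ m ∈ M, m • a = b) ∨ (∃ m ∈ M, m • a = c) ∨ ∃ m ∈ M, m • b = c)
    (hedge : ∀ a b, E a b → ¬ ∃ m ∈ M, m • a = b) : False := by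
  obtain ⟨u₁, u₂, hne, h1, h2⟩ := h.in_two u
  obtain ⟨w, hw⟩ := h.exists_out u
  have hw1 : w ≠ u₁ := fun he => h.asymm _ _ h1 (he ▸ hw)
  have hw2 : w ≠ u₂ := fun he => h.asymm _ _ h2 (he ▸ hw)
  have hsymm : ∀ a b : V, (∃ m ∈ M, m • a = b) → ∃ m ∈ M, m • b = a := by
    rintro a _ ⟨m, hm, rfl⟩
    exact ⟨m⁻¹, M.inv_mem hm, inv_smul_smul _ _⟩
  have hno1 : ¬ ∃ m ∈ M, m • u = u₁ := fun hx => hedge _ _ h1 (hsymm _ _ hx)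
  have hno2 : ¬ ∃ m ∈ M, m • u = u₂ := fun hx => hedge _ _ h2 (hsymm _ _ hx)
  have hno : ¬ ∃ m ∈ M, m • u = w := hedge _ _ hw
  have hne' : ∀ a b : V, a ≠ b → (¬ ∃ m ∈ M, m • u = a) → (¬ ∃ m ∈ M, m • u = b) → ℓ a ≠ ℓ b := by
    intro a b hab ha hb hlab
    obtain ⟨m, hm, rfl⟩ := ((htwo u a b).resolve_left ha).resolve_left hb
    rw [hM m hm a hlab.symm, one_smul] at hab
    exact hab rfl
  have e1 := hne' _ _ hne hno1 hno2
  have e2 := hne' _ _ hw1 hno hno1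
  have e3 := hne' _ _ hw2 hno hno2
  have a1' : ℓ u₁ = ℓ u - 1 ∨ ℓ u₁ = ℓ u + 1 := by
    rcases hl.adj _ _ h1 with a | a <;> rw [a] <;> simp
  have a2' : ℓ u₂ = ℓ u - 1 ∨ ℓ u₂ = ℓ u + 1 := by
    rcases hl.adj _ _ h2 with a | a <;> rw [a] <;> simp
  have a3 := hl.adj _ _ hw
  grind

/-- An element fixing every level has a `2`-power power in `N`, because it differs from an element
of `N` by an element of a vertex stabiliser. -/
theorem exists_pow_mem [Finite V] [N.Normal] (h : OrientedAction G E) (hl : CycleLevel N E ℓ)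
    {g : G} (hg : ∀ v, ℓ (g • v) = ℓ v) : ∃ a, g ^ 2 ^ a ∈ N := by
  obtain ⟨v, -⟩ := hl.surjective 0
  obtain ⟨n, hn, hnv⟩ := (hl.orbit _ _).1 (hg v).symm
  obtain ⟨a, ha⟩ := h.exists_pow_eq_one (g := n⁻¹ * g) (v := v) (by
    rw [mul_smul, ← hnv, inv_smul_smul])
  refine ⟨a, ?_⟩
  have hmk : (g : G ⧸ N) = ((n⁻¹ * g : G) : G ⧸ N) := by
    rw [QuotientGroup.eq]
    have := ‹N.Normal›.conj_mem _ (N.inv_mem hn) g⁻¹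
    simpa [mul_assoc] using this
  rw [← QuotientGroup.eq_one_iff, QuotientGroup.mk_pow, hmk, ← QuotientGroup.mk_pow, ha,
    QuotientGroup.mk_one]

/-- If the kernel `K` of the action on the cycle is a `2`-group, the minimal normal subgroup `N`
is central in `K`. Every element of `K` then acts on each level as an element of `N`, and `K` is
commutative. -/
theorem kernel_comm [Finite G] (h : OrientedAction G E) (hl : CycleLevel N E ℓ)
    {K : Subgroup G} [hKn : K.Normal] (hK : ∀ g, g ∈ K ↔ ∀ v, ℓ (g • v) = ℓ v) (hK2 : IsPGroup 2 K)
    (hN : IsMinimalNormal N) (hNK : N ≤ K) : ∀ a ∈ K, ∀ b ∈ K, a * b = b * a := by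
  have hNn := hN.1
  have hcent : N ≤ Subgroup.centralizer K := by
    refine (hN.le_or_inf_eq_bot inferInstance).resolve_right fun hbot => ?_
    let _ : MulAction K N := MulAction.compHom N
      (((MulAut.conjNormal : G →* MulAut N).comp K.subtype))
    have hsmul : ∀ (k : K) (n : N), ((k • n : N) : G) = k * n * (k : G)⁻¹ := fun k n =>
      MulAut.conjNormal_apply _ _
    have hN2 : IsPGroup 2 N := hK2.to_le hNK
    have hNnt : Nontrivial N := (Subgroup.nontrivial_iff_ne_bot N).2 hN.2.1
    have hdvd : 2 ∣ Nat.card N := by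
      have : Fact (Nat.Prime 2) := ⟨Nat.prime_two⟩
      obtain ⟨n, hn⟩ := IsPGroup.iff_card.1 hN2
      rw [hn]
      refine dvd_pow_self 2 fun h0 => ?_
      rw [h0, pow_zero] at hn
      exact absurd hn (Finite.one_lt_card (α := N)).ne'
    have : Fact (Nat.Prime 2) := ⟨Nat.prime_two⟩
    obtain ⟨b, hb, hb1⟩ := hK2.exists_fixed_point_of_prime_dvd_card_of_fixed_point N hdvd (a := 1)
      (fun k => Subtype.ext (by rw [hsmul]; simp))
    refine hb1 (Subtype.ext (Eq.symm ?_))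
    rw [OneMemClass.coe_one, ← Subgroup.mem_bot, ← hbot]
    refine ⟨b.2, Subgroup.mem_centralizer_iff.2 fun k hk => ?_⟩
    have := congrArg Subtype.val (hb ⟨k, hk⟩)
    rw [hsmul] at this
    exact mul_inv_eq_iff_eq_mul.1 this
  have hcomm : ∀ n ∈ N, ∀ k ∈ K, k * n = n * k := fun n hn k hk =>
    Subgroup.mem_centralizer_iff.1 (hcent hn) k hk
  intro a ha b hb
  refine h.ext_of_smul fun v => ?_
  obtain ⟨n, hn, hnv⟩ := (hl.orbit _ _).1 ((hK a).1 ha v).symm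
  obtain ⟨m, hm, hmv⟩ := (hl.orbit _ _).1 ((hK b).1 hb v).symm
  rw [mul_smul, mul_smul, ← hnv, ← hmv, ← mul_smul, ← mul_smul, hcomm m hm a ha, hcomm n hn b hb,
    mul_smul, mul_smul, ← hnv, ← hmv, ← mul_smul, ← mul_smul, hcomm m hm n (hNK hn)]

theorem mem_kernel_of_smul_eq [N.Normal] (h : OrientedAction G E) (hl : CycleLevel N E ℓ)
    (ho : LevelOriented E ℓ) {g : G} {u : V} (hu : ℓ (g • u) = ℓ u) (v : V) :
    ℓ (g • v) = ℓ v := by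
  obtain ⟨c, hc⟩ := hl.exists_rotation_of_levelOriented h ho g
  rw [hc] at hu ⊢
  have : c = 0 := by linear_combination hu
  rw [this, add_zero]

theorem locallyAbelian [N.Normal] (h : OrientedAction G E) (hl : CycleLevel N E ℓ)
    (ho : LevelOriented E ℓ) {K : Subgroup G} (hK : ∀ g, g ∈ K ↔ ∀ v, ℓ (g • v) = ℓ v)
    (hcomm : ∀ a ∈ K, ∀ b ∈ K, a * b = b * a) :
    LocallyAbelian E ((MulAction.toPermHom G V).comp K.subtype) ℓ where
  homogeneous u v := by
    obtain ⟨g, hg⟩ := h.trans u v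
    exact ⟨MulAction.toPerm g, fun a b => (h.rel_iff g a b).symm, hg⟩
  out_two := h.out_two
  in_two := h.in_two
  comm a b x := by
    change (a : G) • (b : G) • x = (b : G) • (a : G) • x
    rw [← mul_smul, ← mul_smul, hcomm a a.2 b b.2]
  rel a u w hE := h.rel a u w hE
  out_trans u w w' hw hw' := by
    obtain ⟨g, hg, hgw⟩ := h.arc_trans u w u w' hw hw'
    exact ⟨⟨g, (hK g).2 (hl.mem_kernel_of_smul_eq h ho (u := u) (by rw [hg]))⟩, hg, hgw⟩
  in_trans w u u' hu hu' := by
    obtain ⟨g, hg, hgw⟩ := h.arc_trans u w u' w hu hu'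
    exact ⟨⟨g, (hK g).2 (hl.mem_kernel_of_smul_eq h ho (u := w) (by rw [hgw]))⟩, hgw, hg⟩
  closed := h.closed
  level := ho

theorem index_le [Finite V] [Finite G] [N.Normal] (h : OrientedAction G E) (hl : CycleLevel N E ℓ)
    (ho : LevelOriented E ℓ) : N.index ≤ r * 2 ^ r := by
  have := hl.neZero
  obtain ⟨v, -⟩ := hl.surjective 0
  have : Nonempty V := ⟨v⟩
  have hla : LevelAction N E (MulAction.toPermHom G V) ℓ :=
    { inj := fun a b hab => h.ext_of_smul fun v => DFunLike.congr_fun hab v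
      rel := h.rel
      trans := h.trans
      out_two := h.out_two
      closed := h.closed
      level := ho
      orbit := fun u v => (hl.orbit u v).1 }
  exact hla.index_le

/-! ### Generators of an abelian minimal normal subgroup -/

/-- In the oriented case a semiregular commutative minimal normal subgroup `N` is generated by one
element for each level: the element `x` carrying one out-neighbour of a vertex to the other. Up to
inversion `x` depends only on the level of the vertex, so the set of these elements and their
inverses is closed under conjugation. -/
theorem exists_generators_of_levelOriented (h : OrientedAction G E) (hl : CycleLevel N E ℓ)
    (ho : LevelOriented E ℓ) (hN : IsMinimalNormal N) (hcomm : ∀ a ∈ N, ∀ b ∈ N, a * b = b * a)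
    (hsemi : ∀ n ∈ N, ∀ v : V, n • v = v → n = 1) :
    ∃ y : ZMod r → G, Subgroup.closure (Set.range y) = N := by
  have hNn := hN.1
  choose v hv using hl.surjective
  choose w w' hne hw using fun i => h.out_two (v i)
  have hEw : ∀ i, E (v i) (w i) := fun i => (hw i _).2 (Or.inl rfl)
  have hEw' : ∀ i, E (v i) (w' i) := fun i => (hw i _).2 (Or.inr rfl)
  choose y hyN hy using fun i => (hl.orbit (w i) (w' i)).1
    (by rw [ho _ _ (hEw i), ho _ _ (hEw' i)])
  refine ⟨y, ?_⟩
  have hfree : ∀ a ∈ N, ∀ b ∈ N, ∀ u : V, a • u = b • u → a = b := by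
    intro a ha b hb u hab
    rw [← inv_mul_eq_one]
    refine hsemi _ (N.mul_mem (N.inv_mem ha) hb) u ?_
    rw [mul_smul, ← hab, inv_smul_smul]
  let D : Set G := {x | x ∈ N ∧ ∃ u z, E u z ∧ E u (x • z)}
  have hD : Subgroup.closure D = N := by
    refine hN.closure_eq (x := y 0) (fun x hx => hx.1) ?_ ⟨hyN 0, v 0, w 0, hEw 0, by
      rw [hy]; exact hEw' 0⟩ fun h1 => hne 0 (by rw [← hy 0, h1, one_smul])
    rintro x ⟨hx, u, z, hz, hxz⟩ g
    refine ⟨hNn.conj_mem x hx g, g • u, g • z, h.rel g _ _ hz, ?_⟩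
    rw [mul_smul, inv_smul_smul, mul_smul]
    exact h.rel g _ _ hxz
  apply le_antisymm
  · rw [Subgroup.closure_le]
    rintro _ ⟨i, rfl⟩
    exact hyN i
  · rw [← hD, Subgroup.closure_le]
    rintro x ⟨hx, u, z, hz, hxz⟩
    obtain ⟨n, hn, hnu⟩ := (hl.orbit (v (ℓ u)) u).1 (hv _)
    set i := ℓ u
    obtain ⟨z, rfl⟩ : ∃ z', n • z' = z := ⟨n⁻¹ • z, smul_inv_smul _ _⟩
    rw [← hnu, h.rel_iff, hw] at hz
    rw [← hnu, ← mul_smul, hcomm x hx n hn, mul_smul, h.rel_iff, hw] at hxz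
    have hyi : y i ∈ Subgroup.closure (Set.range y) := Subgroup.subset_closure ⟨i, rfl⟩
    rcases hz with rfl | rfl
    · rcases hxz with hxz | hxz
      · rw [hsemi x hx _ hxz]
        exact one_mem _
      · rw [hfree x hx (y i) (hyN i) (w i) (by rw [hxz, hy])]
        exact hyi
    · rcases hxz with hxz | hxz
      · rw [← hy, ← mul_smul] at hxz
        rw [mul_eq_one_iff_eq_inv.1 (hsemi _ (N.mul_mem hx (hyN i)) _ hxz)]
        exact inv_mem hyi
      · rw [hsemi x hx _ hxz]
        exact one_mem _

/-- In the unoriented case let `w` be a nontrivial element of the kernel `K` which a reflection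
`b` of the cycle centralises or inverts. When `K` is commutative, the conjugates of `w` by
the rotations are permuted by `G` up to inversion. They generate `K`, and so does their product,
if it is nontrivial; if it is trivial, one of them is redundant. -/
theorem exists_generators_of_levelUnoriented [N.Normal] (h : OrientedAction G E)
    (hl : CycleLevel N E ℓ) (hu : LevelUnoriented E ℓ) {K : Subgroup G}
    (hK : ∀ g, g ∈ K ↔ ∀ v, ℓ (g • v) = ℓ v) (hKm : IsMinimalNormal K)
    (hcomm : ∀ a ∈ K, ∀ b ∈ K, a * b = b * a) :
    ∃ (ι : Type) (_ : Fintype ι) (y : ι → G), Fintype.card ι ≤ r - 1 ∧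
      Subgroup.closure (Set.range y) = K := by
  classical
  have hr := hl.three_le
  have := hl.neZero
  have hKn := hKm.1
  have hconj : ∀ g g' : G, (∀ v, ℓ (g • v) = ℓ (g' • v)) → ∀ x ∈ K,
      g * x * g⁻¹ = g' * x * g'⁻¹ := by
    intro g g' hgg x hx
    have hmem : g'⁻¹ * g ∈ K := (hK _).2 fun v => by
      have := hl.smul_congr g'⁻¹ (hgg v)
      rwa [inv_smul_smul, ← mul_smul] at this
    have := hcomm _ hmem x hx
    calc g * x * g⁻¹ = g' * (g'⁻¹ * g * x) * g⁻¹ := by group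
      _ = g' * x * g'⁻¹ := by rw [this]; group
  obtain ⟨b, hb⟩ := hl.exists_affine_of_levelUnoriented h hu (Or.inr rfl) 0
  choose a ha using fun c => hl.exists_affine_of_levelUnoriented h hu (Or.inl rfl) c
  obtain ⟨w, hwK, hw1, hbw⟩ : ∃ w ∈ K, w ≠ 1 ∧ (b * w * b⁻¹ = w ∨ b * w * b⁻¹ = w⁻¹) := by
    obtain ⟨⟨n, hn⟩, hn1⟩ := Subgroup.ne_bot_iff_exists_ne_one.1 hKm.2.1
    have hn1' : n ≠ 1 := fun he => hn1 (Subtype.ext he)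
    have hbn : b * n * b⁻¹ ∈ K := hKn.conj_mem n hn b
    by_cases hw : n * (b * n * b⁻¹) = 1
    · exact ⟨n, hn, hn1', Or.inr (mul_eq_one_iff_eq_inv'.1 hw)⟩
    · refine ⟨_, K.mul_mem hn hbn, hw, Or.inl ?_⟩
      have hbb := hconj (b * b) 1 (fun v => by rw [mul_smul, hb, hb, one_smul]; ring) n hn
      calc b * (n * (b * n * b⁻¹)) * b⁻¹ = b * n * b⁻¹ * (b * b * n * (b * b)⁻¹) := by group
        _ = b * n * b⁻¹ * n := by rw [hbb]; group
        _ = n * (b * n * b⁻¹) := hcomm _ hbn n hn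
  let y : ZMod r → G := fun i => a i * w * (a i)⁻¹
  have hyK : ∀ i, y i ∈ K := fun i => hKn.conj_mem w hwK _
  obtain ⟨η, hη, hbη⟩ : ∃ η : ℤ, (η = 1 ∨ η = -1) ∧ b * w * b⁻¹ = w ^ η := by
    rcases hbw with hbw | hbw
    exacts [⟨1, Or.inl rfl, by simpa using hbw⟩, ⟨-1, Or.inr rfl, by simpa using hbw⟩]
  -- the action of `G` on the conjugates by conjugation
  have hact : ∀ g : G, ∃ (e : ZMod r ≃ ZMod r) (θ : ℤ), (θ = 1 ∨ θ = -1) ∧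
      ∀ i, g * y i * g⁻¹ = y (e i) ^ θ := by
    intro g
    obtain ⟨ε, c, hε, hg⟩ := hl.affine h g
    rcases hε with rfl | rfl
    · refine ⟨Equiv.addRight c, 1, Or.inl rfl, fun i => ?_⟩
      have := hconj (g * a i) (a (i + c)) (fun v => by
        rw [mul_smul, hg, ha, ha]; ring) w hwK
      simp only [y, Equiv.coe_addRight, zpow_one]
      rw [← this]
      group
    · refine ⟨Equiv.subLeft c, η, hη, fun i => ?_⟩
      have := hconj (g * a i) (a (c - i) * b) (fun v => by
        rw [mul_smul, mul_smul, hg, ha, ha, hb]; ring) w hwK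
      simp only [y, Equiv.subLeft_apply]
      rw [conj_zpow, ← hbη]
      calc g * (a i * w * (a i)⁻¹) * g⁻¹ = g * a i * w * (g * a i)⁻¹ := by group
        _ = a (c - i) * (b * w * b⁻¹) * (a (c - i))⁻¹ := by rw [this]; group
  have hgen : Subgroup.closure (Set.range y) = K := by
    let D : Set G := {x | ∃ i, ∃ θ : ℤ, (θ = 1 ∨ θ = -1) ∧ x = y i ^ θ}
    have hD : Subgroup.closure D = K := by
      refine hKm.closure_eq (x := y 0) ?_ ?_ ⟨0, 1, Or.inl rfl, by simp⟩ ?_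
      · rintro _ ⟨i, θ, -, rfl⟩
        exact K.zpow_mem (hyK i) θ
      · rintro _ ⟨i, θ, hθ, rfl⟩ g
        obtain ⟨e, θ', hθ', he⟩ := hact g
        refine ⟨e i, θ' * θ, ?_, ?_⟩
        · rcases hθ with rfl | rfl <;> rcases hθ' with rfl | rfl <;> simp
        · rw [← conj_zpow, he, zpow_mul]
      · exact fun h1 => hw1 (by simpa [y] using h1)
    apply le_antisymm
    · rw [Subgroup.closure_le]
      rintro _ ⟨i, rfl⟩
      exact hyK i
    · rw [← hD, Subgroup.closure_le]
      rintro _ ⟨i, θ, -, rfl⟩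
      have hi : y i ∈ Subgroup.closure (Set.range y) := Subgroup.subset_closure ⟨i, rfl⟩
      exact zpow_mem hi θ
  let _ : CommGroup K := { (inferInstance : Group K) with
    mul_comm := fun a b => Subtype.ext (hcomm a a.2 b b.2) }
  let Y : ZMod r → K := fun i => ⟨y i, hyK i⟩
  let s : K := ∏ i, Y i
  have hs : ∀ g : G, ∃ θ : ℤ, (θ = 1 ∨ θ = -1) ∧ g * s * g⁻¹ = (s : G) ^ θ := by
    intro g
    obtain ⟨e, θ, hθ, he⟩ := hact g
    refine ⟨θ, hθ, ?_⟩
    have h1 : MulAut.conjNormal g s = s ^ θ := by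
      simp only [s]
      rw [map_prod, ← Finset.prod_zpow, ← Equiv.prod_comp e fun i => Y i ^ θ]
      refine Finset.prod_congr rfl fun i _ => Subtype.ext ?_
      rw [MulAut.conjNormal_apply]
      exact he i
    have h2 := congrArg Subtype.val h1
    rwa [MulAut.conjNormal_apply] at h2
  by_cases hs1 : s = 1
  · refine ⟨{i : ZMod r // i ≠ 0}, inferInstance, fun i : {i : ZMod r // i ≠ 0} => y i, ?_, ?_⟩
    · rw [Fintype.card_subtype_compl, ZMod.card]
      simp
    · apply le_antisymm
      · rw [Subgroup.closure_le]
        rintro _ ⟨i, rfl⟩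
        exact hyK i
      · rw [← hgen, Subgroup.closure_le]
        have hne : ∀ i, i ≠ 0 → y i ∈
            Subgroup.closure (Set.range fun i : {i : ZMod r // i ≠ 0} => y i) :=
          fun i hi => Subgroup.subset_closure ⟨⟨i, hi⟩, rfl⟩
        rintro _ ⟨i, rfl⟩
        by_cases hi : i = 0
        · subst hi
          have h1 : Y 0 * ∏ i ∈ Finset.univ.erase 0, Y i = 1 := by
            rw [Finset.mul_prod_erase _ _ (Finset.mem_univ _)]
            exact hs1
          have h2 : Y 0 = (∏ i ∈ Finset.univ.erase 0, Y i)⁻¹ := mul_eq_one_iff_eq_inv.1 h1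
          have h3 : ∏ i ∈ Finset.univ.erase 0, Y i ∈ (Subgroup.closure
              (Set.range fun i : {i : ZMod r // i ≠ 0} => y i)).subgroupOf K :=
            prod_mem fun i hi => hne i (Finset.ne_of_mem_erase hi)
          have h4 := inv_mem h3
          rw [← h2] at h4
          exact h4
        · exact hne i hi
  · refine ⟨Unit, inferInstance, fun _ => s, by simp; omega, ?_⟩
    let D : Set G := {x | ∃ θ : ℤ, (θ = 1 ∨ θ = -1) ∧ x = (s : G) ^ θ}
    have hD : Subgroup.closure D = K := by
      refine hKm.closure_eq (x := s) ?_ ?_ ⟨1, Or.inl rfl, by simp⟩ fun h1 => hs1 (Subtype.ext h1)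
      · rintro _ ⟨θ, -, rfl⟩
        exact K.zpow_mem s.2 θ
      · rintro _ ⟨θ, hθ, rfl⟩ g
        obtain ⟨θ', hθ', he⟩ := hs g
        refine ⟨θ' * θ, ?_, ?_⟩
        · rcases hθ with rfl | rfl <;> rcases hθ' with rfl | rfl <;> simp
        · rw [← conj_zpow, he, zpow_mul]
    apply le_antisymm
    · rw [Subgroup.closure_le]
      rintro _ ⟨i, rfl⟩
      exact s.2
    · refine hD.ge.trans ((Subgroup.closure_le _).2 ?_)
      rintro _ ⟨θ, -, rfl⟩
      have hs : (s : G) ∈ Subgroup.closure (Set.range fun _ : Unit => (s : G)) :=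
        Subgroup.subset_closure ⟨(), rfl⟩
      exact zpow_mem hs θ

end CycleLevel
end Levels
end GraphPair

/-! ### Orientations of half-arc-transitive graphs -/

namespace GraphPair

section Orientation

variable {V : Type u} {Γ : SimpleGraph V} {G : Subgroup (Γ ≃g Γ)}

/-- The arcs of a member of `OG(4)` fall into two orbits, each consisting of the reversals of the
arcs in the other; either orbit is an orientation of in- and out-valency two. -/
theorem InOG.exists_orientedAction [Finite V] (h : InOG Γ G 4) :
    ∃ E : V → V → Prop, OrientedAction G E ∧ ∀ u w, Γ.Adj u w ↔ E u w ∨ E w u := by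
  classical
  obtain ⟨hconn, hval, hvt, het, hnat⟩ := h
  have hadj : ∀ g ∈ G, ∀ u w, Γ.Adj u w → Γ.Adj (g u) (g w) := fun g _ u w huw =>
    g.map_rel_iff.2 huw
  obtain ⟨x⟩ := hconn.nonempty
  obtain ⟨y, hxy⟩ : ∃ y, Γ.Adj x y := by
    have : (Γ.neighborSet x).Nonempty := by
      rw [← Set.ncard_pos (Set.toFinite _), hval]
      norm_num
    exact this
  let E : V → V → Prop := fun u w => ∃ g ∈ G, g x = u ∧ g y = w
  have hEadj : ∀ u w, E u w → Γ.Adj u w := by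
    rintro _ _ ⟨g, hg, rfl, rfl⟩
    exact hadj g hg _ _ hxy
  have hiff : ∀ u w, Γ.Adj u w ↔ E u w ∨ E w u := by
    refine fun u w => ⟨fun huw => ?_, fun h => h.elim (hEadj u w) fun h => (hEadj w u h).symm⟩
    obtain ⟨g, hg, hgf⟩ := het s(x, y) hxy s(u, w) huw
    rw [Sym2.map_mk, Sym2.eq_iff] at hgf
    exact hgf.imp (fun h => ⟨g, hg, h⟩) fun h => ⟨g, hg, h⟩
  have harc : ∀ u w u' w', E u w → E u' w' → ∃ g ∈ G, g u = u' ∧ g w = w' := by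
    rintro _ _ _ _ ⟨g, hg, rfl, rfl⟩ ⟨g', hg', rfl, rfl⟩
    exact ⟨g' * g⁻¹, G.mul_mem hg' (G.inv_mem hg), by simp [RelIso.mul_apply],
      by simp [RelIso.mul_apply]⟩
  have hasymm : ∀ u w, E u w → ¬ E w u := by
    intro u w hE hE'
    obtain ⟨s, hs, hsu, hsw⟩ := harc _ _ _ _ hE hE'
    refine hnat fun a b a' b' hab hab' => ?_
    have hall : ∀ a b, Γ.Adj a b → E a b := by
      intro a b hab
      rcases (hiff a b).1 hab with h | h
      · exact h
      · obtain ⟨g, hg, rfl, rfl⟩ := harc _ _ _ _ hE h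
        obtain ⟨k, hk, rfl, rfl⟩ := hE
        exact ⟨g * s * k, G.mul_mem (G.mul_mem hg hs) hk, by
          simp [RelIso.mul_apply, hsu], by simp [RelIso.mul_apply, hsw]⟩
    exact harc _ _ _ _ (hall a b hab) (hall a' b' hab')
  have hrel : ∀ g ∈ G, ∀ u w, E u w → E (g u) (g w) := by
    rintro g hg _ _ ⟨k, hk, rfl, rfl⟩
    exact ⟨g * k, G.mul_mem hg hk, rfl, rfl⟩
  have hrel' : ∀ g ∈ G, ∀ u w, E (g u) (g w) → E u w := by
    intro g hg u w hE
    simpa using hrel g⁻¹ (G.inv_mem hg) _ _ hE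
  let _ : Fintype V := Fintype.ofFinite V
  let d : V → ℕ := fun u => (Finset.univ.filter fun w => E u w).card
  let d' : V → ℕ := fun u => (Finset.univ.filter fun w => E w u).card
  have hd : ∀ u v, d u = d v := by
    intro u v
    obtain ⟨g, hg, rfl⟩ := hvt u v
    refine Finset.card_bij (fun w _ => g w) (fun w hw => ?_) (fun a _ b _ hab => g.injective hab)
      fun w hw => ?_
    · simpa using hrel g hg _ _ (by simpa using hw)
    · obtain ⟨w, rfl⟩ := g.surjective w
      exact ⟨w, by simpa using hrel' g hg _ _ (by simpa using hw), rfl⟩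
  have hd' : ∀ u v, d' u = d' v := by
    intro u v
    obtain ⟨g, hg, rfl⟩ := hvt u v
    refine Finset.card_bij (fun w _ => g w) (fun w hw => ?_) (fun a _ b _ hab => g.injective hab)
      fun w hw => ?_
    · simpa using hrel g hg _ _ (by simpa using hw)
    · obtain ⟨w, rfl⟩ := g.surjective w
      exact ⟨w, by simpa using hrel' g hg _ _ (by simpa using hw), rfl⟩
  have hsum : ∀ u, d u + d' u = 4 := by
    intro u
    rw [← hval u, ← Finset.card_union_of_disjoint, ← Set.ncard_coe_finset]
    · congr 1
      ext w
      simp [hiff]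
    · rw [Finset.disjoint_filter]
      exact fun w _ => hasymm u w
  have hdd : d x = d' x := by
    have h1 : ∑ u, d u = ∑ u, d' u :=
      Finset.sum_card_bipartiteAbove_eq_sum_card_bipartiteBelow (s := Finset.univ)
        (t := Finset.univ) E
    rw [Finset.sum_congr rfl fun u _ => hd u x, Finset.sum_congr rfl fun u _ => hd' u x,
      Finset.sum_const, Finset.sum_const] at h1
    have : Nonempty V := ⟨x⟩
    simpa using h1
  have hd2 : ∀ u, d u = 2 := fun u => by
    have := hsum x
    rw [hd u x]
    omega
  have hd2' : ∀ u, d' u = 2 := fun u => by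
    have := hsum x
    rw [hd' u x]
    omega
  refine ⟨E, ⟨?_, ?_, ?_, ?_, hasymm, ?_, ?_, ?_⟩, hiff⟩
  · intro g hg
    exact Subtype.ext (RelIso.ext hg)
  · exact fun g u w hE => hrel g g.2 u w hE
  · intro u v
    obtain ⟨g, hg, hgu⟩ := hvt u v
    exact ⟨⟨g, hg⟩, hgu⟩
  · intro u w u' w' hE hE'
    obtain ⟨g, hg, hgu, hgw⟩ := harc u w u' w' hE hE'
    exact ⟨⟨g, hg⟩, hgu, hgw⟩
  · intro u
    obtain ⟨a, b, hab, he⟩ := Finset.card_eq_two.1 (hd2 u)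
    exact ⟨a, b, hab, fun z => by simpa using Finset.ext_iff.1 he z⟩
  · intro u
    obtain ⟨a, b, hab, he⟩ := Finset.card_eq_two.1 (hd2' u)
    exact ⟨a, b, hab, by simpa using (Finset.ext_iff.1 he a).2 (by simp),
      by simpa using (Finset.ext_iff.1 he b).2 (by simp)⟩
  · -- the sets of vertices reachable from the ends of an arc have the same size, so they are equal
    let reach : V → Set V := fun u => {v | Relation.ReflTransGen E u v}
    have hcard : ∀ u v, (reach u).ncard = (reach v).ncard := by
      intro u v
      obtain ⟨g, hg, rfl⟩ := hvt u v
      have himg : reach (g u) = g '' reach u := by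
        ext z
        constructor
        · intro hz
          refine ⟨g.symm z, ?_, by simp⟩
          have := Relation.ReflTransGen.lift (p := E) g.symm
            (fun a b hab => hrel' g hg _ _ (by simpa using hab)) _ _ hz
          simpa [reach, Function.onFun] using this
        · rintro ⟨z, hz, rfl⟩
          exact Relation.ReflTransGen.lift (p := E) g (fun a b hab => hrel g hg _ _ hab) _ _ hz
      rw [himg, Set.ncard_image_of_injective _ g.injective]
    have hback : ∀ u w, E u w → u ∈ reach w := by
      intro u w hE
      have hsub : reach w ⊆ reach u := fun z hz => Relation.ReflTransGen.head hE hz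
      rw [Set.eq_of_subset_of_ncard_le hsub (hcard u w).le (Set.toFinite _)]
      exact Relation.ReflTransGen.refl
    intro S ⟨v, hv⟩ hcl
    have hreach : ∀ u ∈ S, ∀ z ∈ reach u, z ∈ S := by
      intro u hu z hz
      induction hz with
      | refl => exact hu
      | tail _ hE ih => exact hcl _ ih _ hE
    ext z
    refine iff_of_true ?_ trivial
    obtain ⟨p⟩ := hconn.preconnected v z
    induction p with
    | nil => exact hv
    | cons hadj _ ih =>
      refine ih ?_
      rcases (hiff _ _).1 hadj with hE | hE
      · exact hcl _ hv _ hE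
      · exact hreach _ hv _ (hback _ _ hE)

end Orientation

/-! ### Cyclic normal quotients as level functions -/

section QuotientCycles

variable {V : Type u} {Γ : SimpleGraph V} {G : Subgroup (Γ ≃g Γ)} {E : V → V → Prop}

theorem orbit_mk_eq_iff {N : Subgroup G} {u v : V} :
    (Quotient.mk _ u : MulAction.orbitRel.Quotient N V) = Quotient.mk _ v ↔
      ∃ n ∈ N, n • u = v := by
  rw [Quotient.eq]
  constructor
  · rintro ⟨n, hn⟩
    have hn' : (n : G) • v = u := hn
    exact ⟨(n : G)⁻¹, N.inv_mem n.2, by rw [← hn', inv_smul_smul]⟩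
  · rintro ⟨n, hn, rfl⟩
    exact ⟨⟨n⁻¹, N.inv_mem hn⟩, inv_smul_smul n u⟩

theorem mem_orbitKernel_iff {N : Subgroup G} [N.Normal] {g : G} :
    g ∈ orbitKernel N ↔ ∀ v : V, ∃ n ∈ N, n • v = g • v := by
  rw [orbitKernel, MonoidHom.mem_ker]
  constructor
  · intro h v
    exact orbit_mk_eq_iff.1 (DFunLike.congr_fun h (Quotient.mk _ v)).symm
  · intro h
    refine RelIso.ext fun B => ?_
    induction B using Quotient.inductionOn with | h v
    exact (orbit_mk_eq_iff.2 (h v)).symm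

theorem le_orbitKernel (N : Subgroup G) [N.Normal] : N ≤ orbitKernel N := fun n hn =>
  mem_orbitKernel_iff.2 fun _ => ⟨n, hn, rfl⟩

theorem orbitKernel_le_of_le {L M : Subgroup G} [L.Normal] [M.Normal] (h : L ≤ orbitKernel M) :
    orbitKernel L ≤ orbitKernel M := by
  intro g hg
  rw [mem_orbitKernel_iff] at hg ⊢
  intro v
  obtain ⟨l, hl, hlv⟩ := hg v
  obtain ⟨m, hm, hmv⟩ := mem_orbitKernel_iff.1 (h hl) v
  exact ⟨m, hm, hmv.trans hlv⟩

/-- If the quotient graph has an edge, then no edge joins vertices of one orbit. -/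
theorem not_same_orbit (h : OrientedAction G E) (hE : ∀ u w, Γ.Adj u w ↔ E u w ∨ E w u)
    {N : Subgroup G} [N.Normal] {B C : MulAction.orbitRel.Quotient N V}
    (hBC : (quotientGraph N).Adj B C) {u w : V} (huw : E u w) : ¬ ∃ n ∈ N, n • u = w := by
  rintro ⟨n, hn, rfl⟩
  obtain ⟨hne, a, b, rfl, rfl, hab⟩ := hBC
  rcases (hE a b).1 hab with hab | hab
  · obtain ⟨g, rfl, rfl⟩ := h.arc_trans _ _ _ _ huw hab
    exact hne (orbit_mk_eq_iff.2 ⟨g * n * g⁻¹, ‹N.Normal›.conj_mem n hn g, by simp [mul_smul]⟩)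
  · obtain ⟨g, rfl, rfl⟩ := h.arc_trans _ _ _ _ huw hab
    exact hne.symm (orbit_mk_eq_iff.2 ⟨g * n * g⁻¹, ‹N.Normal›.conj_mem n hn g,
      by simp [mul_smul]⟩)

theorem exists_cycleLevel (h : OrientedAction G E) (hE : ∀ u w, Γ.Adj u w ↔ E u w ∨ E w u)
    {N : Subgroup G} [N.Normal] {r : ℕ} (hr : 3 ≤ r)
    (e : quotientGraph N ≃g SimpleGraph.cycleGraph r) :
    ∃ ℓ : V → ZMod r, CycleLevel N E ℓ := by
  obtain ⟨n, rfl⟩ : ∃ n, r = n + 3 := ⟨r - 3, by omega⟩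
  let ℓ : V → ZMod (n + 3) := fun v => (e (Quotient.mk _ v) : Fin (n + 3))
  have hcyc : ∀ i j : ZMod (n + 3), (SimpleGraph.cycleGraph (n + 3)).Adj i j ↔
      i - j = 1 ∨ j - i = 1 := fun i j => SimpleGraph.cycleGraph_adj
  have hex : ∀ i : ZMod (n + 3), ∃ u w, Γ.Adj u w ∧ ℓ u = i ∧ ℓ w = i + 1 := by
    intro i
    have h1 : (SimpleGraph.cycleGraph (n + 3)).Adj i (i + 1 : ZMod (n + 3)) :=
      (hcyc i (i + 1)).2 (Or.inr (by ring))
    obtain ⟨-, a, b, ha, hb, hab⟩ := e.symm.map_rel_iff.2 h1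
    refine ⟨a, b, hab, ?_, ?_⟩
    · simp only [ℓ]
      rw [ha]
      exact e.apply_symm_apply _
    · simp only [ℓ]
      rw [hb]
      exact e.apply_symm_apply _
  have h01 : (quotientGraph N).Adj (e.symm (0 : ZMod (n + 3))) (e.symm (1 : ZMod (n + 3))) :=
    e.symm.map_rel_iff.2 ((hcyc 0 1).2 (Or.inr (by ring)))
  refine ⟨ℓ, hr, fun u v => ?_, fun u w huw => ?_, fun i => ?_⟩
  · rw [← orbit_mk_eq_iff]
    exact e.injective.eq_iff
  · have h1 : (quotientGraph N).Adj (Quotient.mk _ u) (Quotient.mk _ w) :=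
      ⟨fun he => not_same_orbit h hE h01 huw (orbit_mk_eq_iff.1 he), u, w, rfl, rfl,
        (hE u w).2 (Or.inl huw)⟩
    rcases (hcyc (ℓ u) (ℓ w)).1 (e.map_rel_iff.2 h1) with h2 | h2
    · right; linear_combination -h2
    · left; linear_combination h2
  · obtain ⟨u, w, huw, hu, hw⟩ := hex i
    exact ⟨u, w, (hE u w).1 huw, hu, hw⟩

theorem CycleLevel.mem_orbitKernel {N : Subgroup G} [N.Normal] {r : ℕ} {ℓ : V → ZMod r}
    (hl : CycleLevel N E ℓ) (g : G) : g ∈ orbitKernel N ↔ ∀ v, ℓ (g • v) = ℓ v := by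
  rw [mem_orbitKernel_iff]
  exact forall_congr' fun v => by rw [← hl.orbit, eq_comm]

/-- A homomorphism with the same kernel as the action on the quotient graph identifies the group
induced on the quotient graph. -/
theorem nonempty_inducedGroup_mulEquiv {N : Subgroup G} [N.Normal] {P : Type*} [Group P]
    (ρ : G →* P) (hρ : Function.Surjective ρ) (hker : ∀ g, ρ g = 1 ↔ g ∈ orbitKernel N) :
    Nonempty (inducedGroup N ≃* P) := by
  have hk : (quotientHom N).ker = ρ.ker := by
    ext g
    rw [MonoidHom.mem_ker (f := ρ), hker]
    rfl
  exact ⟨(QuotientGroup.quotientKerEquivRange (quotientHom N)).symm.trans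
    ((QuotientGroup.quotientMulEquivOfEq hk).trans
      (QuotientGroup.quotientKerEquivOfSurjective ρ hρ))⟩

theorem connected_and_hasValency_of_iso {N : Subgroup G} {r : ℕ} (hr : 3 ≤ r)
    (e : quotientGraph N ≃g SimpleGraph.cycleGraph r) :
    (quotientGraph N).Connected ∧ HasValency (quotientGraph N) 2 := by
  obtain ⟨n, rfl⟩ : ∃ n, r = n + 3 := ⟨r - 3, by omega⟩
  refine ⟨e.connected_iff.2 SimpleGraph.cycleGraph_connected, fun B => ?_⟩
  rw [← Nat.card_coe_set_eq, Nat.card_congr (e.mapNeighborSet B), Nat.card_eq_fintype_card,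
    SimpleGraph.card_neighborSet_eq_degree, SimpleGraph.cycleGraph_degree_three_le]

theorem CycleLevel.isOrientedQuotient (h : OrientedAction G E)
    (hE : ∀ u w, Γ.Adj u w ↔ E u w ∨ E w u) {N : Subgroup G} [N.Normal] {r : ℕ} {ℓ : V → ZMod r}
    (hl : CycleLevel N E ℓ) (e : quotientGraph N ≃g SimpleGraph.cycleGraph r)
    (ho : LevelOriented E ℓ) : IsOrientedQuotient N := by
  choose c hc using hl.exists_rotation_of_levelOriented h ho
  have hc' : ∀ g d, (∀ v, ℓ (g • v) = ℓ v + d) → c g = d := by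
    intro g d hd
    obtain ⟨u, -⟩ := hl.surjective 0
    have := hc g u
    rw [hd] at this
    linear_combination -this
  let ρ : G →* Multiplicative (ZMod r) :=
    { toFun := fun g => Multiplicative.ofAdd (c g)
      map_one' := congrArg _ (hc' 1 0 (by simp))
      map_mul' := fun g g' => congrArg Multiplicative.ofAdd (hc' (g * g') (c g + c g') fun v => by
        rw [mul_smul, hc, hc]; ring) }
  have hρ : Function.Surjective ρ := by
    intro d
    obtain ⟨g, hg⟩ := hl.exists_smul_eq_add_of_levelOriented h ho d.toAdd
    exact ⟨g, congrArg Multiplicative.ofAdd (hc' g _ hg)⟩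
  have hker : ∀ g, ρ g = 1 ↔ g ∈ orbitKernel N := by
    intro g
    rw [hl.mem_orbitKernel]
    constructor
    · intro hg v
      have : c g = 0 := hg
      rw [hc, this, add_zero]
    · intro hg
      exact congrArg Multiplicative.ofAdd (hc' g 0 fun v => by rw [hg, add_zero])
  have hconn := connected_and_hasValency_of_iso hl.three_le e
  refine ⟨r, hl.three_le, ⟨e⟩, nonempty_inducedGroup_mulEquiv ρ hρ hker, hconn.1, hconn.2,
    ?_, ?_, ?_⟩
  · intro B C
    induction B using Quotient.inductionOn with | h u
    induction C using Quotient.inductionOn with | h v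
    obtain ⟨g, rfl⟩ := h.trans u v
    exact ⟨quotientHom N g, ⟨g, rfl⟩, rfl⟩
  · have key : ∀ f ∈ (quotientGraph N).edgeSet, ∃ u w : V, E u w ∧
        f = s(Quotient.mk _ u, Quotient.mk _ w) := by
      intro f
      induction f using Sym2.ind with | h B C
      rintro ⟨-, a, b, rfl, rfl, hab⟩
      rcases (hE a b).1 hab with hab | hab
      · exact ⟨a, b, hab, rfl⟩
      · exact ⟨b, a, hab, Sym2.eq_swap⟩
    intro f hf f' hf'
    obtain ⟨u, w, huw, rfl⟩ := key f hf
    obtain ⟨u', w', huw', rfl⟩ := key f' hf'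
    obtain ⟨g, rfl, rfl⟩ := h.arc_trans _ _ _ _ huw huw'
    exact ⟨quotientHom N g, ⟨g, rfl⟩, rfl⟩
  · intro harc
    obtain ⟨u, -⟩ := hl.surjective 0
    obtain ⟨w, hw⟩ := h.exists_out u
    have hadj : (quotientGraph N).Adj (Quotient.mk _ u) (Quotient.mk _ w) := by
      refine ⟨fun he => ?_, u, w, rfl, rfl, (hE u w).2 (Or.inl hw)⟩
      have h1 := (hl.orbit u w).2 (orbit_mk_eq_iff.1 he)
      rw [ho u w hw] at h1
      have h2 : (1 : ZMod r) = 0 := by linear_combination -h1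
      exact hl.two_ne_zero (by linear_combination 2 * h2)
    obtain ⟨_, ⟨g, rfl⟩, h1, h2⟩ := harc _ _ _ _ hadj hadj.symm
    have h1' : ℓ (g • u) = ℓ w := (hl.orbit _ _).2 (orbit_mk_eq_iff.1 h1)
    have h2' : ℓ (g • w) = ℓ u := (hl.orbit _ _).2 (orbit_mk_eq_iff.1 h2)
    rw [hc, ho _ _ hw] at h1' h2'
    exact hl.two_ne_zero (by linear_combination h2' - h1')

theorem CycleLevel.isUnorientedQuotient (h : OrientedAction G E)
    (hE : ∀ u w, Γ.Adj u w ↔ E u w ∨ E w u) {N : Subgroup G} [N.Normal] {r : ℕ} {ℓ : V → ZMod r}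
    (hl : CycleLevel N E ℓ) (e : quotientGraph N ≃g SimpleGraph.cycleGraph r)
    (hu : LevelUnoriented E ℓ) :
    IsUnorientedQuotient N ∧ Nonempty (inducedGroup N ≃* DihedralGroup r) := by
  classical
  choose ε c hε hc using hl.affine h
  have huniq : ∀ g ε' c', (∀ v, ℓ (g • v) = ε' * ℓ v + c') → ε g = ε' ∧ c g = c' :=
    fun g ε' c' hg => hl.affine_unique fun v => by rw [← hc, hg]
  have h11 : (-1 : ZMod r) ≠ 1 := fun he => hl.two_ne_zero (by linear_combination -he)
  have hmul : ∀ g g', ε (g * g') = ε g * ε g' ∧ c (g * g') = ε g * c g' + c g :=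
    fun g g' => huniq _ _ _ fun v => by rw [mul_smul, hc, hc]; ring
  have hone := huniq 1 1 0 fun v => by simp
  -- `DihedralGroup.r i` stands for the rotation `x ↦ x + i` and `DihedralGroup.sr i` for the
  -- reflection `x ↦ -i - x`
  let ρ : G →* DihedralGroup r :=
    { toFun := fun g => if ε g = 1 then .r (c g) else .sr (-c g)
      map_one' := by rw [if_pos hone.1, hone.2]; rfl
      map_mul' := fun g g' => by
        rw [(hmul g g').1, (hmul g g').2]
        rcases hε g with h1 | h1 <;> rcases hε g' with h2 | h2 <;>
          simp [h1, h2, h11] <;> ring }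
  have hρ : Function.Surjective ρ := by
    rintro (i | i)
    · obtain ⟨g, hg⟩ := hl.exists_affine_of_levelUnoriented h hu (Or.inl rfl) i
      obtain ⟨h1, h2⟩ := huniq g _ _ hg
      exact ⟨g, by simp [ρ, h1, h2]⟩
    · obtain ⟨g, hg⟩ := hl.exists_affine_of_levelUnoriented h hu (Or.inr rfl) (-i)
      obtain ⟨h1, h2⟩ := huniq g _ _ hg
      exact ⟨g, by simp [ρ, h1, h2, h11]⟩
  have hker : ∀ g, ρ g = 1 ↔ g ∈ orbitKernel N := by
    intro g
    rw [hl.mem_orbitKernel]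
    constructor
    · intro hg v
      rcases hε g with h1 | h1
      · have h2 : DihedralGroup.r (c g) = 1 := by simpa [ρ, h1] using hg
        rw [DihedralGroup.one_def] at h2
        injection h2 with h2
        rw [hc, h1, h2]
        ring
      · have h2 : DihedralGroup.sr (-c g) = 1 := by
          have h3 : ρ g = DihedralGroup.sr (-c g) := by simp [ρ, h1, h11]
          rw [← h3, hg]
        rw [DihedralGroup.one_def] at h2
        injection h2
    · intro hg
      obtain ⟨h1, h2⟩ := huniq g 1 0 fun v => by rw [hg]; ring
      simp [ρ, h1, h2]
  have hconn := connected_and_hasValency_of_iso hl.three_le e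
  have hequiv := nonempty_inducedGroup_mulEquiv ρ hρ hker
  refine ⟨⟨r, hl.three_le, ⟨e⟩, hequiv, hconn.1, hconn.2, ?_⟩, hequiv⟩
  rintro B C B' C' ⟨-, a, b, rfl, rfl, hab⟩ ⟨-, a', b', rfl, rfl, hab'⟩
  have hstep : ∀ u w, Γ.Adj u w → ∃ δ, (δ = 1 ∨ δ = -1) ∧ ℓ w = ℓ u + δ := by
    intro u w huw
    rcases (hE u w).1 huw with huw | huw <;> rcases hl.adj _ _ huw with h1 | h1
    · exact ⟨1, Or.inl rfl, h1⟩
    · exact ⟨-1, Or.inr rfl, by rw [h1]; ring⟩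
    · exact ⟨-1, Or.inr rfl, by rw [h1]; ring⟩
    · exact ⟨1, Or.inl rfl, by rw [h1]; ring⟩
  obtain ⟨δ, hδ, hb⟩ := hstep _ _ hab
  obtain ⟨δ', hδ', hb'⟩ := hstep _ _ hab'
  have hδδ : δ * δ = 1 := by rcases hδ with rfl | rfl <;> ring
  have hpm : δ' * δ = 1 ∨ δ' * δ = -1 := by
    rcases hδ with rfl | rfl <;> rcases hδ' with rfl | rfl <;> simp
  obtain ⟨g, hg⟩ := hl.exists_affine_of_levelUnoriented h hu hpm (ℓ a' - δ' * δ * ℓ a)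
  refine ⟨quotientHom N g, ⟨g, rfl⟩, orbit_mk_eq_iff.2 ((hl.orbit _ _).1 ?_),
    orbit_mk_eq_iff.2 ((hl.orbit _ _).1 ?_)⟩
  · rw [hg]; ring
  · rw [hg, hb, hb']; linear_combination δ' * hδδ

end QuotientCycles
end GraphPair

/-! ### The finest cyclic normal quotient -/

namespace GraphPair

section Basic

variable {V : Type u} {Γ : SimpleGraph V} {G : Subgroup (Γ ≃g Γ)} {E : V → V → Prop}

/-- A quotient that refines a cycle of length at least three is neither `K₁` nor `K₂`. -/
theorem IsDegenerate.isCycleGraph_of_le {N M : Subgroup G} [N.Normal] {r : ℕ} {ℓ : V → ZMod r}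
    (hl : CycleLevel N E ℓ) (hM : IsDegenerate (quotientGraph M)) (hMN : M ≤ orbitKernel N) :
    IsCycleGraph (quotientGraph M) := by
  have hfac : ∀ u v : V, (Quotient.mk _ u : MulAction.orbitRel.Quotient M V) = Quotient.mk _ v →
      ℓ u = ℓ v := by
    intro u v huv
    obtain ⟨m, hm, rfl⟩ := orbit_mk_eq_iff.1 huv
    exact ((hl.mem_orbitKernel m).1 (hMN hm) u).symm
  obtain ⟨a, ha⟩ := hl.surjective 0
  obtain ⟨b, hb⟩ := hl.surjective 1
  obtain ⟨c, hc⟩ := hl.surjective 2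
  have h2 := hl.two_ne_zero
  have h1 : (1 : ZMod r) ≠ 0 := fun h => h2 (by linear_combination 2 * h)
  let m : V → MulAction.orbitRel.Quotient M V := Quotient.mk _
  have hab : m b ≠ m a := fun h => h1 ((hb.symm.trans (hfac b a h)).trans ha)
  have hac : m c ≠ m a := fun h => h2 ((hc.symm.trans (hfac c a h)).trans ha)
  have hbc : m c ≠ m b := fun h => h1 (by
    have := (hc.symm.trans (hfac c b h)).trans hb
    linear_combination this)
  rcases hM with ⟨⟨e⟩⟩ | ⟨⟨e⟩⟩ | h
  · exact absurd (e.injective (Subsingleton.elim _ _)) hab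
  · have hab' : e (m b) ≠ e (m a) := fun h => hab (e.injective h)
    have hac' : e (m c) ≠ e (m a) := fun h => hac (e.injective h)
    have hbc' : e (m c) ≠ e (m b) := fun h => hbc (e.injective h)
    omega
  · exact h

/-- The trivial subgroup does not give a cycle, since `Γ` has valency four. -/
theorem ne_bot_of_isCycleGraph (h : OrientedAction G E) (hE : ∀ u w, Γ.Adj u w ↔ E u w ∨ E w u)
    {N : Subgroup G} [N.Normal] (hN : IsCycleGraph (quotientGraph N)) : N ≠ ⊥ := by
  rintro rfl
  obtain ⟨r, hr, ⟨e⟩⟩ := hN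
  obtain ⟨ℓ, hl⟩ := exists_cycleLevel h hE hr e
  obtain ⟨u, -⟩ := hl.surjective 0
  obtain ⟨v, hvu, hlv⟩ := hl.exists_ne_same_level h u
  obtain ⟨n, hn, rfl⟩ := (hl.orbit u v).1 hlv.symm
  rw [Subgroup.mem_bot.1 hn, one_smul] at hvu
  exact hvu rfl

/-- The cyclic normal quotient `Γ_N` refines all others. -/
def IsFinestCyclic (N : Subgroup G) [N.Normal] : Prop :=
  IsCyclicQuotient N ∧ ∀ (M : Subgroup G) [M.Normal], IsCyclicQuotient M →
    orbitKernel N ≤ orbitKernel M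

/-- Without independent cyclic normal quotients there is a finest one. -/
theorem exists_isFinestCyclic [Finite V] (h : OrientedAction G E)
    (hE : ∀ u w, Γ.Adj u w ↔ E u w ∨ E w u) (hcyc : IsBasicOfCycleType Γ G)
    (hindep : ¬ HasIndependentCyclicQuotients Γ G) :
    ∃ (N : Subgroup G) (_ : N.Normal), IsFinestCyclic N := by
  have : Finite (Γ ≃g Γ) := DFunLike.finite _
  obtain ⟨-, N₀, hN₀, hc₀⟩ := hcyc
  obtain ⟨K, ⟨N, hN, hc, rfl⟩, hmin⟩ := exists_minimal_of_wellFoundedLT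
    (fun K : Subgroup G => ∃ (N : Subgroup G) (_ : N.Normal), IsCyclicQuotient N ∧
      K = orbitKernel N) ⟨_, N₀, hN₀, hc₀, rfl⟩
  refine ⟨N, hN, hc, fun M hM hMc => ?_⟩
  have hL : IsCycleGraph (quotientGraph (orbitKernel M ⊓ orbitKernel N)) := by
    by_contra hcon
    exact hindep ⟨M, N, hM, hN, hMc, hc, hcon⟩
  have hle := orbitKernel_le_of_le (L := orbitKernel M ⊓ orbitKernel N) (M := N) inf_le_right
  have hle' := orbitKernel_le_of_le (L := orbitKernel M ⊓ orbitKernel N) (M := M) inf_le_left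
  exact (hmin ⟨_, inferInstance, ⟨ne_bot_of_isCycleGraph h hE hL, hL⟩, rfl⟩ hle).trans hle'

/-- All minimal normal subgroups fix every vertex of the finest cyclic normal quotient. -/
theorem IsMinimalNormal.le_orbitKernel (h : OrientedAction G E)
    (hE : ∀ u w, Γ.Adj u w ↔ E u w ∨ E w u) {N : Subgroup G} [N.Normal] (hN : IsFinestCyclic N)
    {M : Subgroup G} (hM : IsMinimalNormal M) (hMd : IsDegenerate (quotientGraph M)) :
    M ≤ orbitKernel N := by
  have hMn := hM.1
  obtain ⟨⟨-, r, hr, ⟨e⟩⟩, hfin⟩ := hN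
  obtain ⟨ℓ, hl⟩ := exists_cycleLevel h hE hr e
  refine (hM.le_or_inf_eq_bot inferInstance).resolve_right fun hbot => ?_
  have hfree : ∀ m ∈ M, ∀ v, ℓ (m • v) = ℓ v → m = 1 := fun m hm v hv =>
    hl.eq_one_of_inf_eq_bot h hl.mem_orbitKernel hM hbot hm hv
  obtain ⟨u, -⟩ := hl.surjective 0
  obtain ⟨v, hvu, hlv⟩ := hl.exists_ne_same_level h u
  have hnot : ¬ ∃ m ∈ M, m • u = v := by
    rintro ⟨m, hm, rfl⟩
    exact hvu (by rw [hfree m hm u hlv, one_smul])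
  rcases hMd with ⟨⟨f⟩⟩ | ⟨⟨f⟩⟩ | hcyc
  · exact hnot (orbit_mk_eq_iff.1 (f.injective (Subsingleton.elim _ _)))
  · have h01 : (quotientGraph M).Adj (f.symm 0) (f.symm 1) :=
      f.symm.map_rel_iff.2 (by simp)
    refine hl.not_two_orbits h hfree u (fun a b c => ?_) fun a b hab =>
      not_same_orbit h hE h01 hab
    simp only [← orbit_mk_eq_iff, ← f.injective.eq_iff]
    omega
  · obtain ⟨n, hn, hnu⟩ := (hl.orbit u v).1 hlv.symm
    obtain ⟨m, hm, hmu⟩ := mem_orbitKernel_iff.1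
      (hfin M ⟨hM.2.1, hcyc⟩ (GraphPair.le_orbitKernel N hn)) u
    exact hnot ⟨m, hm, hmu.trans hnu⟩

/-- Every minimal normal subgroup has the vertices of the finest cyclic normal quotient as its
orbits. -/
theorem IsMinimalNormal.isFinestCyclic (h : OrientedAction G E)
    (hE : ∀ u w, Γ.Adj u w ↔ E u w ∨ E w u) (hbasic : IsBasic Γ G)
    {N : Subgroup G} [N.Normal] (hN : IsFinestCyclic N) {M : Subgroup G} [hMn : M.Normal]
    (hM : IsMinimalNormal M) : IsFinestCyclic M := by
  have hMd := hbasic.2 M hM.2.1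
  have hle := hM.le_orbitKernel h hE hN hMd
  obtain ⟨⟨-, r, hr, ⟨e⟩⟩, hfin⟩ := hN
  obtain ⟨ℓ, hl⟩ := exists_cycleLevel h hE hr e
  exact ⟨⟨hM.2.1, hMd.isCycleGraph_of_le hl hle⟩, fun L _ hL =>
    (orbitKernel_le_of_le hle).trans (hfin L hL)⟩

theorem isOrientedQuotient_of_isFinestCyclic (h : OrientedAction G E)
    (hE : ∀ u w, Γ.Adj u w ↔ E u w ∨ E w u) {N : Subgroup G} [N.Normal] {r : ℕ} {ℓ : V → ZMod r}
    (hl : CycleLevel N E ℓ) (ho : LevelOriented E ℓ) (hN : IsFinestCyclic N) (M : Subgroup G)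
    [M.Normal] (hM : IsCyclicQuotient M) : IsOrientedQuotient M := by
  obtain ⟨s, hs, ⟨f⟩⟩ := hM.2
  obtain ⟨ℓ', hl'⟩ := exists_cycleLevel h hE hs f
  have href : ∀ u v, ℓ u = ℓ v → ℓ' u = ℓ' v := by
    intro u v huv
    obtain ⟨n, hn, rfl⟩ := (hl.orbit u v).1 huv
    exact ((hl'.mem_orbitKernel n).1 (hN.2 M hM (le_orbitKernel N hn)) u).symm
  rcases hl'.dichotomy h with ho' | ho' | hu'
  · exact hl'.isOrientedQuotient h hE f ho'
  · exact hl'.neg.isOrientedQuotient h hE f ho'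
  · exact absurd hu' (hl.not_levelUnoriented_of_refine ho hl' href)

theorem isUnorientedQuotient_of_isFinestCyclic (h : OrientedAction G E)
    (hE : ∀ u w, Γ.Adj u w ↔ E u w ∨ E w u) {N : Subgroup G} [N.Normal] {r : ℕ} {ℓ : V → ZMod r}
    (hl : CycleLevel N E ℓ) (hu : LevelUnoriented E ℓ) (hN : IsFinestCyclic N) (M : Subgroup G)
    [M.Normal] (hM : IsCyclicQuotient M) : IsUnorientedQuotient M := by
  obtain ⟨s, hs, ⟨f⟩⟩ := hM.2
  obtain ⟨ℓ', hl'⟩ := exists_cycleLevel h hE hs f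
  have href : ∀ u v, ℓ u = ℓ v → ℓ' u = ℓ' v := by
    intro u v huv
    obtain ⟨n, hn, rfl⟩ := (hl.orbit u v).1 huv
    exact ((hl'.mem_orbitKernel n).1 (hN.2 M hM (le_orbitKernel N hn)) u).symm
  rcases hl'.dichotomy h with ho' | ho' | hu'
  · exact absurd ho' (hl.not_levelOriented_of_refine hu hl' href)
  · exact absurd ho' (hl.not_levelOriented_of_refine hu hl'.neg fun u v huv => by
      rw [href u v huv])
  · exact (hl'.isUnorientedQuotient h hE f hu').1

/-- A commutative minimal normal subgroup that is not a `2`-group meets the vertex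
stabilisers, which are `2`-groups, trivially: its elements of `2`-power order form a normal subgroup. -/
theorem IsMinimalNormal.semiregular [Finite V] (h : OrientedAction G E) {N : Subgroup G}
    (hN : IsMinimalNormal N) (hcomm : ∀ a ∈ N, ∀ b ∈ N, a * b = b * a) (hN2 : ¬ IsPGroup 2 N)
    {n : G} (hn : n ∈ N) {v : V} (hv : n • v = v) : n = 1 := by
  by_contra hn1
  have hNn := hN.1
  let S : Subgroup G :=
    { carrier := {x | x ∈ N ∧ ∃ a, x ^ 2 ^ a = 1}
      one_mem' := ⟨N.one_mem, 0, by simp⟩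
      mul_mem' := by
        rintro x y ⟨hx, a, ha⟩ ⟨hy, b, hb⟩
        refine ⟨N.mul_mem hx hy, a + b, ?_⟩
        have hxy : Commute x y := hcomm x hx y hy
        rw [hxy.mul_pow, pow_add, pow_mul, ha, one_pow, one_mul, mul_comm (2 ^ a), pow_mul, hb,
          one_pow]
      inv_mem' := by
        rintro x ⟨hx, a, ha⟩
        exact ⟨N.inv_mem hx, a, by rw [inv_pow, ha, inv_one]⟩ }
  have hS : S.Normal := by
    refine ⟨?_⟩
    rintro x ⟨hx, a, ha⟩ g
    exact ⟨hNn.conj_mem x hx g, a, by rw [conj_pow, ha, mul_one, mul_inv_cancel]⟩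
  have hSN := hN.2.2 S hS (fun hbot => hn1 (Subgroup.mem_bot.1 (hbot ▸
    (⟨hn, h.exists_pow_eq_one hv⟩ : n ∈ S)))) fun x hx => hx.1
  refine hN2 fun x => ?_
  obtain ⟨-, a, ha⟩ := hSN.ge x.2
  exact ⟨a, Subtype.ext ha⟩

end Basic

end GraphPair

/-! ### The structure of basic pairs of cycle type -/

open GraphPair in
theorem theorem1p1 {V : Type u} [Finite V] (Γ : SimpleGraph V) (G : Subgroup (Γ ≃g Γ))
    (hbasic : GraphPair.IsBasicOfCycleType Γ G)
    (hindep : ¬ GraphPair.HasIndependentCyclicQuotients Γ G) :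
    ((∀ (M : Subgroup G) [M.Normal],
        GraphPair.IsCyclicQuotient M → GraphPair.IsOrientedQuotient M) ∧
      ((IsPGroup 2 (GraphPair.socle G) ∧
          ∃ r t : ℕ, 3 ≤ r ∧ 1 ≤ t ∧
            Nonempty (Γ ≃g GraphPair.highlyArcTransitiveGraph r 2 t)) ∨
        ∃ N : Subgroup G, GraphPair.IsUniqueMinimalNormal N ∧
          ∃ (T : Type u) (_ : Group T) (k r : ℕ),
            IsSimpleGroup T ∧ ¬ Nonempty (T ≃* Multiplicative (ZMod 2)) ∧
            1 ≤ k ∧ Nonempty (N ≃* (Fin k → T)) ∧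
            3 ≤ r ∧ Nonempty (GraphPair.quotientGraph N ≃g SimpleGraph.cycleGraph r) ∧
            (¬ IsMulCommutative N → k ≤ r * 2 ^ r) ∧
            (IsMulCommutative N → k ≤ r))) ∨
    ((∀ (M : Subgroup G) [M.Normal],
        GraphPair.IsCyclicQuotient M → GraphPair.IsUnorientedQuotient M) ∧
      ∃ N : Subgroup G, GraphPair.IsUniqueMinimalNormal N ∧
        ∃ (T : Type u) (_ : Group T) (k r : ℕ),
          IsSimpleGroup T ∧
          1 ≤ k ∧ Nonempty (N ≃* (Fin k → T)) ∧
          3 ≤ r ∧ Nonempty (GraphPair.quotientGraph N ≃g SimpleGraph.cycleGraph r) ∧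
          (¬ IsMulCommutative N → k ≤ 2 * r) ∧
          (IsMulCommutative N → k ≤ r - 1)) := by
  have hfinite : Finite (Γ ≃g Γ) := DFunLike.finite _
  obtain ⟨E, h, hE⟩ := hbasic.1.1.exists_orientedAction
  obtain ⟨N₀, hN₀, hfin₀⟩ := exists_isFinestCyclic h hE hbasic hindep
  -- if possible, `N` is chosen to be a `2`-group
  obtain ⟨N, hN, hN2⟩ : ∃ N : Subgroup G, IsMinimalNormal N ∧
      ((∃ M : Subgroup G, IsMinimalNormal M ∧ IsPGroup 2 M) → IsPGroup 2 N) := by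
    by_cases hex : ∃ M : Subgroup G, IsMinimalNormal M ∧ IsPGroup 2 M
    · obtain ⟨M, hM, hM2⟩ := hex
      exact ⟨M, hM, fun _ => hM2⟩
    · obtain ⟨M, hM, -⟩ := exists_isMinimalNormal_le hN₀ hfin₀.1.1
      exact ⟨M, hM, fun h => absurd h hex⟩
  have hNn := hN.1
  have hfin : IsFinestCyclic N := hN.isFinestCyclic h hE hbasic.1 hfin₀
  have hle : ∀ M : Subgroup G, IsMinimalNormal M → M ≤ orbitKernel N := fun M hM => by
    have := hM.1
    exact hM.le_orbitKernel h hE hfin (hbasic.1.2 M hM.2.1)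
  obtain ⟨r, hr, ⟨e⟩⟩ := hfin.1.2
  obtain ⟨ℓ₀, hl₀⟩ := exists_cycleLevel h hE hr e
  obtain ⟨T, hT, k, hTs, hk, ⟨f⟩, hkN⟩ := hN.exists_mulEquiv_pi
  have hcommN : IsMulCommutative N → ∀ a ∈ N, ∀ b ∈ N, a * b = b * a := fun hc a ha b hb =>
    congrArg Subtype.val (hc.is_comm.comm ⟨a, ha⟩ ⟨b, hb⟩)
  obtain ⟨ℓ, hl, htype⟩ : ∃ ℓ : V → ZMod r, CycleLevel N E ℓ ∧
      (LevelOriented E ℓ ∨ LevelUnoriented E ℓ) := by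
    rcases hl₀.dichotomy h with ho | ho | hu
    exacts [⟨_, hl₀, Or.inl ho⟩, ⟨_, hl₀.neg, Or.inl ho⟩, ⟨_, hl₀, Or.inr hu⟩]
  rcases htype with ho | hu
  · refine Or.inl ⟨fun M _ hM => isOrientedQuotient_of_isFinestCyclic h hE hl ho hfin M hM, ?_⟩
    by_cases h2 : IsPGroup 2 N
    · left
      have hK2 : IsPGroup 2 (orbitKernel N) := by
        intro x
        obtain ⟨a, ha⟩ := hl.exists_pow_mem h ((hl.mem_orbitKernel x).1 x.2)
        obtain ⟨b, hb⟩ := h2 ⟨_, ha⟩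
        refine ⟨a + b, Subtype.ext ?_⟩
        have := congrArg Subtype.val hb
        rw [pow_add, pow_mul]
        exact this
      refine ⟨hK2.to_le (sSup_le hle), ?_⟩
      have hla := hl.locallyAbelian h ho hl.mem_orbitKernel
        (hl.kernel_comm h hl.mem_orbitKernel hK2 hN (le_orbitKernel N))
      obtain ⟨v, -⟩ := hl.surjective 0
      have : Nonempty V := ⟨v⟩
      obtain ⟨R, t, hR, ht, f, hf⟩ := hla.exists_equiv hr
      refine ⟨R, t, hR, ht, ⟨⟨f, fun {a b} => ?_⟩⟩⟩
      rw [hE, hf, hf]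
      refine ⟨fun hab => hab.2, fun hab => ⟨fun heq => ?_, hab⟩⟩
      rw [← hf, ← hf, ← hE, f.injective heq] at hab
      exact Γ.irrefl hab
    · right
      have huniq : ∀ M : Subgroup G, IsMinimalNormal M → M = N := by
        intro M hM
        by_contra hne
        refine h2 (hN2 ⟨M, hM, fun m => ?_⟩)
        obtain ⟨a, ha⟩ := hl.exists_pow_mem h ((hl.mem_orbitKernel m).1 (hle M hM m.2))
        refine ⟨a, Subtype.ext (Subgroup.mem_bot.1 ?_)⟩
        rw [← hM.inf_eq_bot hN hne]
        exact ⟨M.pow_mem m.2 _, ha⟩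
      refine ⟨N, ⟨hN, huniq⟩, T, hT, k, r, hTs, ?_, hk, ⟨f⟩, hr, ⟨e⟩,
        fun _ => hkN.trans (hl.index_le h ho), fun hc => ?_⟩
      · rintro ⟨t⟩
        refine h2 fun n => ⟨1, f.injective (funext fun i => t.injective ?_)⟩
        rw [map_pow, map_one]
        have hz : ∀ z : Multiplicative (ZMod 2), z ^ 2 ^ 1 = 1 := by decide
        simpa using hz (t (f n i))
      · obtain ⟨y, hy⟩ := hl.exists_generators_of_levelOriented h ho hN (hcommN hc)
          fun n hn v hv => hN.semiregular h (hcommN hc) h2 hn hv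
        have := hl.neZero
        simpa using le_card_of_mulEquiv_pi (hcommN hc) f y hy
  · refine Or.inr ⟨fun M _ hM => isUnorientedQuotient_of_isFinestCyclic h hE hl hu hfin M hM, ?_⟩
    have hKN : orbitKernel N = N := by
      refine le_antisymm (fun g hg => ?_) (le_orbitKernel N)
      rw [hl.mem_orbitKernel] at hg
      obtain ⟨v, -⟩ := hl.surjective 0
      obtain ⟨n, hn, hnv⟩ := (hl.orbit _ _).1 (hg v).symm
      have hng : n⁻¹ * g = 1 := by
        refine hl.eq_one_of_levelUnoriented h hu (v := v) (fun w => ?_) ?_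
        · have hn' := (hl.mem_orbitKernel n⁻¹).1 (le_orbitKernel N (N.inv_mem hn))
          rw [mul_smul, hn', hg]
        · rw [mul_smul, ← hnv, inv_smul_smul]
      rwa [← inv_mul_eq_one.1 hng]
    have hindex : N.index = 2 * r := by
      obtain ⟨-, ⟨d⟩⟩ := hl.isUnorientedQuotient h hE e hu
      have := hl.neZero
      rw [← DihedralGroup.nat_card (n := r), ← Nat.card_congr d.toEquiv]
      exact (congrArg Subgroup.index hKN).symm.trans (Subgroup.index_ker _)
    refine ⟨N, ⟨hN, fun M hM => hN.2.2 M hM.1 hM.2.1 (hKN ▸ hle M hM)⟩, T, hT, k, r, hTs, hk, ⟨f⟩,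
      hr, ⟨e⟩, fun _ => hindex ▸ hkN, fun hc => ?_⟩
    obtain ⟨ι, _, y, hι, hy⟩ := hl.exists_generators_of_levelUnoriented h hu
      (fun g => by rw [← hl.mem_orbitKernel, hKN]) hN (hcommN hc)
    exact (le_card_of_mulEquiv_pi (hcommN hc) f y hy).trans hι
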